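/- **Setting.** Let $V$ be a finite-dimensional real Euclidean space with inner product $\langle-,-\rangle$ and let $\Phi\subseteq V\setminus\{0\}$ be a finite root system: $s_\alpha(\beta)\in\Phi$ for all $\alpha,\beta\in\Phi$, where $s_\alpha$ is the orthogonal reflection in $\alpha^\perp$, and $\alpha,c\alpha\in\Phi$ with $c\in\mathbb R$ implies $c=\pm1$. ($\Phi$ need neither be crystallographic nor span $V$.) Let $\Pi$ be a simple system of $\Phi$, that is, a linearly independent subset of $\Phi$ such that $\Phi$ is the disjoint union of $\Phi_+:=\Phi\cap\mathbb R_{\ge0}\Pi$ and $-\Phi_+$. Put $S=\{s_\alpha\mid\alpha\in\Pi\}$, so $|S|=|\Pi|$, and let $W=\langle s_\alpha\mid\alpha\in\Phi\rangle$. For $I\subseteq S$ write $\Pi_I=\{\alpha\in\Pi\mid s_\alpha\in I\}$. Fix an integer $n\ge1$. For $J\subseteq I\subseteq S$ let $$\mathcal C_{I,J}=\{v\in V\mid\langle\alpha,v\rangle=0\text{ for }\alpha\in\Pi_J,\ \langle\alpha,v\rangle>0\text{ for }\alpha\in\Pi_{I\setminus J}\}.$$ For a sequence $\mathbf I=(I_0,\dots,I_n)$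 with $S=I_0\supseteq I_1\supseteq\cdots\supseteq I_n$ let $\mathcal X_{\mathbf I}=\mathcal C_{I_0,I_1}\times\cdots\times\mathcal C_{I_{n-1},I_n}\subseteq V^n$. The *strata* are the sets $w(\mathcal X_{\mathbf I})$ with $w\in W$ (acting diagonally on $V^n$). Let $\mathcal F$ be the set of strata, ordered by $F\le G\iff\overline F\subseteq\overline G$, and let $\hat0:=\mathcal X_{(S,\dots,S)}$. Let $\overline{\mathcal F}$ be the set of pairs $(w,\mathbf I)$ with $\mathbf I$ as above, $w\in W$ and $w(\Pi_{I_n})\subseteq\Phi_+$, with the order transferred from $\mathcal F$ along the map $(w,\mathbf I)\mapsto w(\mathcal X_{\mathbf I})$. The element $(1,(S,\dots,S))$ of $\overline{\mathcal F}$ is also denoted $\hat0$. For a finite-dimensional real vector space $U$ let $\mathcal R_U$ be the set of rays $\mathbb R_{>0}v$, $0\ne v\in U$, topologised so that $v\mapsto\mathbb R_{>0}v$ is a homeomorphism from the unit sphere of a norm on $U$ onto $\mathcal R_U$ (the topology does not depend on the norm). For $C\subseteq U$ let $[C]=\{\mathbb R_{>0}v\mid 0\neq v\in C\}$. A *regular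 cell decomposition* of a Hausdorff space $T$ is given by a finite partition of $T$ into sets $e$ (the open cells) such that each closed cell $\overline e$ is homeomorphic to a closed Euclidean ball by a homeomorphism under which $e$ corresponds to the open ball, and such that $\overline e\setminus e$ is a union of closed cells. Its *face poset* is the set of closed cells ordered by inclusion. Let $\mathbb S^{m-1}$ be the unit sphere in $\mathbb R^m$ ($\mathbb S^{-1}=\emptyset$). **Proposition 4.3.** The relation $\le$ is a partial order on $\mathcal F$ with minimum element $\hat0$, and $(w,\mathbf I)\mapsto w(\mathcal X_{\mathbf I})$ is a bijection $\overline{\mathcal F}\to\mathcal F$. Moreover: (a) Suppose that $V=\mathbb R\Pi$. Then $d:=\dim V=|S|$, $\mathcal R_{V^n}\cong\mathbb S^{nd-1}$, and $\{[F]\mid F\in\mathcal F\setminus\{\hat0\}\}$ is the set of open cells of a regular cell decomposition of $\mathcal R_{V^n}$. The map $F\mapsto\overline{[F]}$ is an isomorphism from the poset $\mathcal F\setminus\{\hat0\}$ onto the face poset of this decomposition. (b) In general (without assuming $V=\mathbb R\Pi$), the poset $\overline{\mathcal F}\setminus\{\hat0\}$ is isomorphic to the face poset of a regular cell decomposition of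 $\mathbb S^{n|S|-1}$. Consequently the poset $\overline{\mathcal F}\cup\{\hat1\}$, obtained from $\overline{\mathcal F}$ by adjoining a new maximum element $\hat1$, is finite and graded: it has a minimum and a maximum element, and all its maximal chains have the same cardinality. -/

import Mathlib

open scoped NNReal

noncomputable section

namespace DiagonalStrata

section Euclidean

variable {V : Type*} [NormedAddCommGroup V] [InnerProductSpace ℝ V]

/-- The orthogonal reflection `s_α` in the hyperplane perpendicular to `α`
(for `α ≠ 0`, it is `v ↦ v - 2 ⟪v, α⟫ / ⟪α, α⟫ • α`). -/
def rootRefl (α : V) : V ≃ₗᵢ[ℝ] V := (Submodule.span ℝ {α})ᗮ.reflection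

/-- A finite, reduced, not necessarily crystallographic root system in `V`; it need not span `V`. -/
structure IsRootSystem (Φ : Set V) : Prop where
  finite : Φ.Finite
  zero_notMem : (0 : V) ∉ Φ
  refl_mem : ∀ α ∈ Φ, ∀ β ∈ Φ, rootRefl α β ∈ Φ
  reduced : ∀ α ∈ Φ, ∀ c : ℝ, c • α ∈ Φ → c = 1 ∨ c = -1

/-- `Φ₊ = Φ ∩ ℝ_{≥0} Δ`. -/
def posRoots (Φ Δ : Set V) : Set V := Φ ∩ (Submodule.span ℝ≥0 Δ : Set V)

/-- `Δ` is a simple system of `Φ`: a linearly independent subset of `Φ` such that `Φ` is the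
disjoint union of `Φ₊` and `-Φ₊`. -/
structure IsSimpleSystem (Φ Δ : Set V) : Prop where
  subset : Δ ⊆ Φ
  linearIndep : LinearIndepOn ℝ id Δ
  union_eq : posRoots Φ Δ ∪ -posRoots Φ Δ = Φ
  disjoint : Disjoint (posRoots Φ Δ) (-posRoots Φ Δ)

/-- The reflection group `W` generated by the reflections in the roots. -/
def weylGroup (Φ : Set V) : Subgroup (V ≃ₗᵢ[ℝ] V) := Subgroup.closure (rootRefl '' Φ)

/-- The cone `C_{I,J}` of those `v` with `⟪α, v⟫ = 0` for `α ∈ J` and `⟪α, v⟫ > 0` for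
`α ∈ I \ J`. Throughout, a set of simple reflections is represented by the set of the
corresponding simple roots (`α ↦ s_α` is a bijection from the simple roots to the simple
reflections). -/
def facetCone (I J : Set V) : Set V :=
  {v | (∀ α ∈ J, inner ℝ α v = 0) ∧ ∀ α ∈ I \ J, 0 < inner ℝ α v}

/-- The weakly decreasing sequences `Δ = I₀ ⊇ I₁ ⊇ ⋯ ⊇ Iₙ`. -/
def flags (Δ : Set V) (n : ℕ) : Set (Fin (n + 1) → Set V) := {I | I 0 = Δ ∧ Antitone I}

/-- `X_I = C_{I₀,I₁} × C_{I₁,I₂} × ⋯ × C_{Iₙ₋₁,Iₙ} ⊆ Vⁿ`. -/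
def stdStratum {n : ℕ} (I : Fin (n + 1) → Set V) : Set (Fin n → V) :=
  {v | ∀ i : Fin n, v i ∈ facetCone (I i.castSucc) (I i.succ)}

/-- `w(X_I)`, for the diagonal action of `w` on `Vⁿ`. -/
def translate {n : ℕ} (w : V ≃ₗᵢ[ℝ] V) (I : Fin (n + 1) → Set V) : Set (Fin n → V) :=
  (fun v i => w (v i)) '' stdStratum I

/-- The set `F⁽ⁿ⁾` of strata `w(X_I)` of `Vⁿ`. -/
structure Stratum (Φ Δ : Set V) (n : ℕ) where
  carrier : Set (Fin n → V)
  exists_eq : ∃ w ∈ weylGroup Φ, ∃ I ∈ flags Δ n, carrier = translate w I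

/-- `F ≤ G` if and only if `closure F ⊆ closure G`. -/
instance (Φ Δ : Set V) (n : ℕ) : Preorder (Stratum Φ Δ n) :=
  Preorder.lift fun F => closure F.carrier

/-- The stratum `0̂ = X_{(S, …, S)}`. -/
def Stratum.zero (Φ Δ : Set V) (n : ℕ) : Stratum Φ Δ n where
  carrier := translate 1 fun _ => Δ
  exists_eq := ⟨1, one_mem _, fun _ => Δ, ⟨rfl, antitone_const⟩, rfl⟩

/-- The set of pairs `(w, I)` with `I` a weakly decreasing sequence as above and `w ∈ W^{Iₙ}`,
i.e. `w ∈ W` maps the simple roots in `Iₙ` to positive roots. -/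
structure StratumIndex (Φ Δ : Set V) (n : ℕ) where
  w : V ≃ₗᵢ[ℝ] V
  I : Fin (n + 1) → Set V
  w_mem : w ∈ weylGroup Φ
  I_mem : I ∈ flags Δ n
  mapsTo : ∀ α ∈ I (Fin.last n), w α ∈ posRoots Φ Δ

/-- The map `(w, I) ↦ w(X_I)`. -/
def StratumIndex.toStratum {Φ Δ : Set V} {n : ℕ} (p : StratumIndex Φ Δ n) : Stratum Φ Δ n where
  carrier := translate p.w p.I
  exists_eq := ⟨p.w, p.w_mem, p.I, p.I_mem, rfl⟩

/-- The order transferred from the strata: `(w, I) ≤ (w', I')` iff `w(X_I) ≤ w'(X_{I'})`. -/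
instance (Φ Δ : Set V) (n : ℕ) : Preorder (StratumIndex Φ Δ n) :=
  Preorder.lift StratumIndex.toStratum

/-- The index `(1, (S, …, S))` of the stratum `0̂`. -/
def StratumIndex.zero {Φ Δ : Set V} (h : Δ ⊆ Φ) (n : ℕ) : StratumIndex Φ Δ n where
  w := 1
  I := fun _ => Δ
  w_mem := one_mem _
  I_mem := ⟨rfl, antitone_const⟩
  mapsTo := fun _ hα => ⟨h hα, Submodule.subset_span hα⟩

end Euclidean

section Rays

/-- The set of rays `ℝ_{>0} v`, `v ≠ 0`, in `U`. -/
def RaySpace (U : Type*) [AddCommGroup U] [Module ℝ U] : Type _ := Module.Ray ℝ U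

variable {U : Type*} [NormedAddCommGroup U] [NormedSpace ℝ U]

/-- The bijection `v ↦ ℝ_{>0} v` from the boundary of the closed unit ball to the rays. -/
def sphereToRay (v : Metric.sphere (0 : U) 1) : RaySpace U :=
  rayOfNeZero ℝ (v : U) (ne_zero_of_mem_unit_sphere v)

/-- The topology on the rays for which `sphereToRay` is a homeomorphism. (For finite-dimensional
`U`, it does not depend on the norm: the closed unit balls of all norms, and more generally all
convex bodies with `0` in the interior, give the same topology.) -/
instance : TopologicalSpace (RaySpace U) :=
  TopologicalSpace.coinduced (sphereToRay (U := U)) inferInstance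

/-- `[C]`, the set of rays spanned by the non-zero elements of `C`. -/
def raysOf (C : Set U) : Set (RaySpace U) :=
  {r | ∃ v ∈ C, ∃ hv : v ≠ 0, r = (rayOfNeZero ℝ v hv : Module.Ray ℝ U)}

end Rays

section Cells

variable {T : Type*} [TopologicalSpace T]

/-- `E` is the set of open cells of a regular cell decomposition of the Hausdorff space `T`: a
finite partition of `T` such that the closure of each `e ∈ E` is a ball with interior `e` (there is
a homeomorphism from a closed Euclidean ball onto `closure e` mapping the open ball onto `e`), and
the boundary `closure e \ e` of each such ball is a union of closed cells. -/
structure IsRegularCellDecomposition (E : Set (Set T)) : Prop where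
  t2 : T2Space T
  finite : E.Finite
  pairwiseDisjoint : E.PairwiseDisjoint id
  sUnion_eq : ⋃₀ E = Set.univ
  isBall : ∀ e ∈ E, ∃ k : ℕ,
    ∃ h : Metric.closedBall (0 : EuclideanSpace ℝ (Fin k)) 1 ≃ₜ closure e,
      (fun x => (h x : T)) '' {x | (x : EuclideanSpace ℝ (Fin k)) ∈ Metric.ball 0 1} = e
  boundary : ∀ e ∈ E, ∃ A ⊆ E, closure e \ e = ⋃ a ∈ A, closure a

/-- The face poset of a regular cell decomposition with set of open cells `E`: the set of the
closed cells, ordered by inclusion (as a subtype of `Set T`). -/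
abbrev FacePoset (E : Set (Set T)) : Type _ := {c : Set T // ∃ e ∈ E, c = closure e}

end Cells

/-- A poset is graded if it has a minimum and a maximum and all its maximal chains have the same
cardinality. -/
def IsGradedPoset (P : Type*) [Preorder P] : Prop :=
  (∀ a b : P, a ≤ b → b ≤ a → a = b) ∧ (∃ a : P, IsBot a) ∧ (∃ a : P, IsTop a) ∧
    ∀ C D : Set P, IsMaxChain (· ≤ ·) C → IsMaxChain (· ≤ ·) D → C.encard = D.encard

/-- The standard sphere `S^{m-1}` in `ℝ^m` (empty for `m = 0`). -/
abbrev StdSphere (m : ℕ) : Type := Metric.sphere (0 : EuclideanSpace ℝ (Fin m)) 1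

end DiagonalStrata

end

noncomputable section

namespace DiagonalStrata

/-!
Attach to `x ∈ Vⁿ` the set of pairs `(β, i)` such that the root `β` is orthogonal to the entries of
`x` before the `i`-th one and has a non-negative inner product with the `i`-th one. Moving `x` into
lexicographically dominant position by `W` shows that the strata are the classes of points with the
same such set. Hence they are relatively open convex cones, with `F ≤ G` if and only if the set of
`G` is contained in that of `F`. The rays of a relatively open convex cone that does not contain `0`
form an open ball whose closure is a closed ball.

The poset is graded by the dimension of the linear hull. Suppose that `F < G` and that the hull of
`F` has codimension at least two in that of `G`. Let `x ∈ F`, `y ∈ G`, and let `u` lie in the hull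
of `G` but not in the sum of the hull of `F` and `ℝ y`. If `s` is maximal such that `u - s y` points
from `x` into the closure of `G`, then `x + ε (u - s y)` lies strictly between `F` and `G`, for
small `ε > 0`.
-/

section RayTopology

variable {U : Type*} [NormedAddCommGroup U] [NormedSpace ℝ U]
  {U' : Type*} [NormedAddCommGroup U'] [NormedSpace ℝ U']

/-- The ray `ℝ_{>0} v`. -/
def rayOf (v : {v : U // v ≠ 0}) : RaySpace U := rayOfNeZero ℝ v.1 v.2

theorem rayOf_eq_iff (v w : {v : U // v ≠ 0}) :
    rayOf v = rayOf w ↔ ∃ t : ℝ, 0 < t ∧ w.1 = t • v.1 := by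
  refine (ray_eq_iff v.2 w.2).trans ⟨fun h => ?_, ?_⟩
  · obtain ⟨t, ht, h⟩ := h.exists_pos_left v.2 w.2
    exact ⟨t, ht, h.symm⟩
  · rintro ⟨t, ht, h⟩
    exact h ▸ SameRay.sameRay_pos_smul_right v.1 ht

theorem rayOf_surjective : Function.Surjective (rayOf (U := U)) := fun r => by
  induction r using Module.Ray.ind with
  | h v hv => exact ⟨⟨v, hv⟩, rfl⟩

/-- The normalization of a non-zero vector, a section of `sphereToRay` on the rays. -/
def unitVector (v : {v : U // v ≠ 0}) : Metric.sphere (0 : U) 1 :=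
  ⟨‖v.1‖⁻¹ • v.1, by simp [norm_smul, v.2]⟩

theorem continuous_unitVector : Continuous (unitVector (U := U)) :=
  ((continuous_subtype_val.norm.inv₀ fun v => norm_ne_zero_iff.2 v.2).smul
    continuous_subtype_val).subtype_mk _

theorem sphereToRay_unitVector (v : {v : U // v ≠ 0}) : sphereToRay (unitVector v) = rayOf v :=
  (rayOf_eq_iff ⟨_, ne_zero_of_mem_unit_sphere (unitVector v)⟩ v).2
    ⟨‖v.1‖, norm_pos_iff.2 v.2, by simp [unitVector, smul_smul, v.2]⟩

theorem continuous_rayOf : Continuous (rayOf (U := U)) := by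
  have h : sphereToRay ∘ unitVector = rayOf (U := U) := funext sphereToRay_unitVector
  rw [← h]
  exact continuous_coinduced_rng.comp continuous_unitVector

theorem sphereToRay_bijective : Function.Bijective (sphereToRay (U := U)) := by
  constructor
  · intro v w h
    have hray : SameRay ℝ v.1 w.1 :=
      (ray_eq_iff (ne_zero_of_mem_unit_sphere v) (ne_zero_of_mem_unit_sphere w)).1 h
    exact Subtype.ext (hray.eq_of_norm_eq (by simp))
  · intro r
    obtain ⟨v, rfl⟩ := rayOf_surjective r
    exact ⟨unitVector v, sphereToRay_unitVector v⟩

/-- `sphereToRay` as a homeomorphism from the unit sphere onto the space of rays. -/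
def sphereHomeoRay : Metric.sphere (0 : U) 1 ≃ₜ RaySpace U :=
  (Equiv.ofBijective sphereToRay sphereToRay_bijective).toHomeomorph fun _ => Iff.rfl

instance : T2Space (RaySpace U) := (sphereHomeoRay (U := U)).t2Space

instance [FiniteDimensional ℝ U] : CompactSpace (RaySpace U) :=
  (sphereHomeoRay (U := U)).compactSpace

theorem continuous_raySpace_iff {X : Type*} [TopologicalSpace X] {g : RaySpace U → X} :
    Continuous g ↔ Continuous (g ∘ rayOf) := by
  refine ⟨fun h => h.comp continuous_rayOf, fun h => continuous_coinduced_dom.2 ?_⟩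
  exact h.comp (continuous_subtype_val.subtype_mk ne_zero_of_mem_unit_sphere)

theorem rayOf_mem_raysOf {C : Set U} (hC : ∀ ⦃t : ℝ⦄, 0 < t → ∀ ⦃x⦄, x ∈ C → t • x ∈ C)
    (v : {v : U // v ≠ 0}) : rayOf v ∈ raysOf C ↔ v.1 ∈ C := by
  refine ⟨?_, fun h => ⟨v.1, h, v.2, rfl⟩⟩
  rintro ⟨w, hw, hw0, h⟩
  obtain ⟨t, ht, h⟩ := (rayOf_eq_iff ⟨w, hw0⟩ v).1 h.symm
  exact h ▸ hC ht hw

theorem raysOf_eq_image (C : Set U) : raysOf C = rayOf '' {v : {v : U // v ≠ 0} | v.1 ∈ C} := by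
  ext r
  constructor
  · rintro ⟨v, hvC, hv, rfl⟩
    exact ⟨⟨v, hv⟩, hvC, rfl⟩
  · rintro ⟨v, hvC, rfl⟩
    exact ⟨v.1, hvC, v.2, rfl⟩

theorem closure_raysOf {C : Set U} (hC : ∀ ⦃t : ℝ⦄, 0 < t → ∀ ⦃x⦄, x ∈ C → t • x ∈ C) :
    closure (raysOf C) = raysOf (closure C) := by
  apply Set.Subset.antisymm
  · refine closure_minimal (fun r ⟨v, hvC, hv, h⟩ => ⟨v, subset_closure hvC, hv, h⟩)
      (isClosed_coinduced.2 ?_)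
    have hC' : ∀ ⦃t : ℝ⦄, 0 < t → ∀ ⦃x⦄, x ∈ closure C → t • x ∈ closure C := fun t ht x hx =>
      map_mem_closure (continuous_const_smul t) hx fun y hy => hC ht hy
    have hpre : sphereToRay ⁻¹' raysOf (closure C) =
        (Subtype.val : Metric.sphere (0 : U) 1 → U) ⁻¹' closure C :=
      Set.ext fun v => rayOf_mem_raysOf hC' ⟨v.1, ne_zero_of_mem_unit_sphere v⟩
    exact hpre ▸ isClosed_closure.preimage continuous_subtype_val
  · rw [raysOf_eq_image, raysOf_eq_image]
    have hopen : IsOpenMap (Subtype.val : {v : U // v ≠ 0} → U) :=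
      isOpen_ne.isOpenEmbedding_subtypeVal.isOpenMap
    exact (Set.image_mono
      (hopen.preimage_closure_eq_closure_preimage continuous_subtype_val C).subset).trans
        (image_closure_subset_closure_image continuous_rayOf)

/-- The map of rays induced by an injective linear map. -/
def rayMap (g : U →ₗ[ℝ] U') (hg : Function.Injective g) : RaySpace U → RaySpace U' :=
  Quotient.map (fun v => ⟨g v.1, (map_ne_zero_iff g hg).2 v.2⟩) fun _ _ h => h.map g

theorem rayMap_rayOf (g : U →ₗ[ℝ] U') (hg : Function.Injective g) (v : {v : U // v ≠ 0}) :
    rayMap g hg (rayOf v) = rayOf ⟨g v.1, (map_ne_zero_iff g hg).2 v.2⟩ := rfl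

theorem rayMap_injective (g : U →ₗ[ℝ] U') (hg : Function.Injective g) :
    Function.Injective (rayMap g hg) := by
  intro r s h
  obtain ⟨v, rfl⟩ := rayOf_surjective r
  obtain ⟨w, rfl⟩ := rayOf_surjective s
  rw [rayMap_rayOf, rayMap_rayOf] at h
  obtain ⟨t, ht, h⟩ := (rayOf_eq_iff _ _).1 h
  exact (rayOf_eq_iff v w).2 ⟨t, ht, hg (h.trans (map_smul g t v.1).symm)⟩

theorem isClosedEmbedding_rayMap [FiniteDimensional ℝ U] (g : U →ₗ[ℝ] U')
    (hg : Function.Injective g) : Topology.IsClosedEmbedding (rayMap g hg) := by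
  refine Continuous.isClosedEmbedding (continuous_raySpace_iff.2 ?_) (rayMap_injective g hg)
  exact continuous_rayOf.comp ((g.continuous_of_finiteDimensional.comp
    continuous_subtype_val).subtype_mk fun v => (map_ne_zero_iff g hg).2 v.2)

theorem raysOf_image (g : U →ₗ[ℝ] U') (hg : Function.Injective g) (C : Set U) :
    raysOf (g '' C) = rayMap g hg '' raysOf C := by
  ext r
  constructor
  · rintro ⟨_, ⟨v, hv, rfl⟩, hgv, rfl⟩
    exact ⟨_, ⟨v, hv, (map_ne_zero_iff g hg).1 hgv, rfl⟩, rfl⟩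
  · rintro ⟨_, ⟨v, hv, hv0, rfl⟩, rfl⟩
    exact ⟨g v, ⟨v, hv, rfl⟩, (map_ne_zero_iff g hg).2 hv0, rfl⟩

theorem nonempty_raySpace_homeo_stdSphere [FiniteDimensional ℝ U] {m : ℕ}
    (hm : Module.finrank ℝ U = m) : Nonempty (RaySpace U ≃ₜ StdSphere m) := by
  let e : U ≃ₗ[ℝ] EuclideanSpace ℝ (Fin m) := LinearEquiv.ofFinrankEq _ _ (by simp [hm])
  have hsurj : Function.Surjective (rayMap e.toLinearMap e.injective) := fun r => by
    obtain ⟨v, rfl⟩ := rayOf_surjective r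
    refine ⟨rayOf ⟨e.symm v.1, (map_ne_zero_iff _ e.symm.injective).2 v.2⟩, ?_⟩
    simp [rayMap_rayOf]
  exact ⟨((isClosedEmbedding_rayMap _ e.injective).isEmbedding.toHomeomorphOfSurjective
    hsurj).trans sphereHomeoRay.symm⟩

end RayTopology

section BallCells

variable {T T' : Type*} [TopologicalSpace T] [TopologicalSpace T']

/-- The closure of `e` is a closed Euclidean ball whose open ball is `e`; this is the condition on
the cells of an `IsRegularCellDecomposition`. -/
def IsOpenBallCell (e : Set T) : Prop :=
  ∃ k : ℕ, ∃ h : Metric.closedBall (0 : EuclideanSpace ℝ (Fin k)) 1 ≃ₜ closure e,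
    (fun x => (h x : T)) '' {x | (x : EuclideanSpace ℝ (Fin k)) ∈ Metric.ball 0 1} = e

theorem IsOpenBallCell.image {e : Set T} (he : IsOpenBallCell e) {g : T → T'}
    (hg : Topology.IsClosedEmbedding g) : IsOpenBallCell (g '' e) := by
  obtain ⟨k, h, hball⟩ := he
  refine ⟨k, h.trans ((hg.isEmbedding.homeomorphImage _).trans
    (Homeomorph.setCongr (hg.closure_image_eq _).symm)), ?_⟩
  conv_rhs => rw [← hball, Set.image_image]
  rfl

theorem exists_homeomorph_closedBall {D : Type*} [NormedAddCommGroup D] [NormedSpace ℝ D]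
    [FiniteDimensional ℝ D] {s : Set D} (hs : IsOpen s) (hconv : Convex ℝ s) (hne : s.Nonempty)
    (hbdd : Bornology.IsBounded s) :
    ∃ (k : ℕ) (g : EuclideanSpace ℝ (Fin k) ≃ₜ D),
      g '' Metric.ball 0 1 = s ∧ g '' Metric.closedBall 0 1 = closure s := by
  let e := toEuclidean (E := D)
  have hint : interior (e '' s) = e '' s := (e.toHomeomorph.isOpenMap s hs).interior_eq
  obtain ⟨h, hball, hclosedBall, -⟩ :=
    exists_homeomorph_image_interior_closure_frontier_eq_unitBall (s := e '' s)
      (hconv.linear_image e.toLinearMap) (by rw [hint]; exact hne.image _)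
      (e.lipschitz.isBounded_image hbdd)
  let g := e.toHomeomorph.trans h
  have hg : ∀ s : Set D, h '' (e '' s) = g '' s := fun s => Set.image_image h e s
  refine ⟨_, g.symm, ?_, ?_⟩
  · rw [← hball, hint, hg]
    exact g.toEquiv.symm_image_image _
  · have hclosure : closure (e '' s) = e '' closure s := (e.toHomeomorph.image_closure s).symm
    rw [← hclosedBall, hclosure, hg]
    exact g.toEquiv.symm_image_image _

theorem isOpenBallCell_image_of_convex [T2Space T] {D : Type*} [NormedAddCommGroup D]
    [NormedSpace ℝ D] [FiniteDimensional ℝ D] {s : Set D} (hs : IsOpen s) (hconv : Convex ℝ s)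
    (hne : s.Nonempty) (hbdd : Bornology.IsBounded s) {g : D → T} (hg : Continuous g)
    (hinj : Function.Injective g) : IsOpenBallCell (g '' s) := by
  obtain ⟨k, θ, hball, hclosedBall⟩ := exists_homeomorph_closedBall hs hconv hne hbdd
  let φ : Metric.closedBall (0 : EuclideanSpace ℝ (Fin k)) 1 → T := fun x => g (θ x)
  have hφ : Topology.IsClosedEmbedding φ :=
    (hg.comp (θ.continuous.comp continuous_subtype_val)).isClosedEmbedding
      (hinj.comp (θ.injective.comp Subtype.val_injective))
  have hrange : Set.range φ = closure (g '' s) := by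
    rw [← image_closure_of_isCompact hbdd.isCompact_closure hg.continuousOn, ← hclosedBall,
      Set.image_image, Set.image_eq_range]
  refine ⟨k, hφ.isEmbedding.toHomeomorph.trans (Homeomorph.setCongr hrange), ?_⟩
  have himage : φ '' {x | x.1 ∈ Metric.ball 0 1} = g '' s := by
    rw [← hball, Set.image_image]
    exact Set.Subset.antisymm (fun _ ⟨x, hx, h⟩ => ⟨x, hx, h⟩)
      fun _ ⟨x, hx, h⟩ => ⟨⟨x, Metric.ball_subset_closedBall hx⟩, hx, h⟩
  exact himage

end BallCells

section OpenCones

variable {U : Type*} [NormedAddCommGroup U] [NormedSpace ℝ U]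

/-- The map `y ↦ y + (1 - ‖y‖) u` from `ker ℓ` to `U`, where `ℓ u = 1`. On rays, it restricts to a
homeomorphism from the closed unit ball of `ker ℓ` to the closed hemisphere `ℓ ≥ 0`. -/
def hemisphereChart (ℓ : U →ₗ[ℝ] ℝ) (u : U) (y : LinearMap.ker ℓ) : U := y + (1 - ‖y‖) • u

variable {ℓ : U →ₗ[ℝ] ℝ} {u : U}

theorem continuous_hemisphereChart : Continuous (hemisphereChart ℓ u) := by
  unfold hemisphereChart
  fun_prop

theorem apply_hemisphereChart (hu : ℓ u = 1) (y : LinearMap.ker ℓ) :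
    ℓ (hemisphereChart ℓ u y) = 1 - ‖y‖ := by
  simp [hemisphereChart, hu]

theorem eq_of_hemisphereChart_eq_smul (hu : ℓ u = 1) {y z : LinearMap.ker ℓ} {t : ℝ} (ht : 0 ≤ t)
    (h : hemisphereChart ℓ u z = t • hemisphereChart ℓ u y) : t = 1 ∧ z = y := by
  have hℓ : 1 - ‖z‖ = t * (1 - ‖y‖) := by
    simpa [apply_hemisphereChart hu] using congrArg ℓ h
  have hzy : z = t • y := by
    apply Subtype.ext
    simp only [hemisphereChart, smul_add, smul_smul, ← hℓ] at h
    simpa using h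
  have ht1 : t = 1 := by
    rw [hzy, norm_smul_of_nonneg ht] at hℓ
    linarith
  exact ⟨ht1, by rw [hzy, ht1, one_smul]⟩

theorem hemisphereChart_ne_zero (hu : ℓ u = 1) (y : LinearMap.ker ℓ) :
    hemisphereChart ℓ u y ≠ 0 := fun h =>
  zero_ne_one (eq_of_hemisphereChart_eq_smul hu (y := y) (z := y) le_rfl (by simp [h])).1

theorem exists_hemisphereChart_eq_smul (hu : ℓ u = 1) {v : U} (hv : 0 < ℓ v) :
    ∃ t : ℝ, 0 < t ∧ ∃ y, hemisphereChart ℓ u y = t • v := by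
  let y : LinearMap.ker ℓ := ⟨v - ℓ v • u, by simp [hu]⟩
  have hpos : 0 < ‖y‖ + ℓ v := by positivity
  have ht : 0 < (‖y‖ + ℓ v)⁻¹ := inv_pos.2 hpos
  refine ⟨_, ht, (‖y‖ + ℓ v)⁻¹ • y, ?_⟩
  have hnorm : 1 - ‖(‖y‖ + ℓ v)⁻¹ • y‖ = (‖y‖ + ℓ v)⁻¹ * ℓ v := by
    rw [norm_smul_of_nonneg ht.le]
    field_simp
    ring
  simp only [hemisphereChart, hnorm, Submodule.coe_smul, y, mul_smul, smul_sub, sub_add_cancel]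

theorem convex_preimage_hemisphereChart {C : ConvexCone ℝ U} (huC : u ∈ C) :
    Convex ℝ (hemisphereChart ℓ u ⁻¹' C) := by
  intro y hy z hz a b ha hb hab
  have hnorm : ‖a • y + b • z‖ ≤ a * ‖y‖ + b * ‖z‖ := by
    simpa [norm_smul_of_nonneg ha, norm_smul_of_nonneg hb] using norm_add_le (a • y) (b • z)
  have hcomb : a • hemisphereChart ℓ u y + b • hemisphereChart ℓ u z ∈ C :=
    C.convex hy hz ha hb hab
  have heq : hemisphereChart ℓ u (a • y + b • z) =
      a • hemisphereChart ℓ u y + b • hemisphereChart ℓ u z +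
        (a * ‖y‖ + b * ‖z‖ - ‖a • y + b • z‖) • u := by
    simp only [hemisphereChart, Submodule.coe_add, Submodule.coe_smul]
    linear_combination (norm := module) (-hab) • u
  rw [Set.mem_preimage, heq]
  rcases hnorm.eq_or_lt with h | h
  · simpa [h] using hcomb
  · exact C.add_mem hcomb (C.smul_mem (sub_pos.2 h) huC)

theorem exists_form_pos_of_blunt {C : ConvexCone ℝ U} (hopen : IsOpen (C : Set U))
    (hblunt : C.Blunt) {u : U} (hu : u ∈ C) : ∃ ℓ : U →ₗ[ℝ] ℝ, ℓ u = 1 ∧ ∀ v ∈ C, 0 < ℓ v := by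
  obtain ⟨f, hf⟩ := geometric_hahn_banach_open_point C.convex hopen hblunt
  simp only [map_zero] at hf
  refine ⟨(f u)⁻¹ • f.toLinearMap, by simp [(hf u hu).ne], fun v hv => ?_⟩
  simpa using mul_pos_of_neg_of_neg (inv_lt_zero.2 (hf u hu)) (hf v hv)

theorem isOpenBallCell_raysOf_of_isOpen [FiniteDimensional ℝ U] {C : ConvexCone ℝ U}
    (hopen : IsOpen (C : Set U)) (hblunt : C.Blunt) (hne : (C : Set U).Nonempty) :
    IsOpenBallCell (raysOf (C : Set U)) := by
  obtain ⟨u, huC⟩ := hne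
  obtain ⟨ℓ, hu, hpos⟩ := exists_form_pos_of_blunt hopen hblunt huC
  let chart : LinearMap.ker ℓ → RaySpace U := fun y =>
    rayOf ⟨hemisphereChart ℓ u y, hemisphereChart_ne_zero hu y⟩
  have hchart : Continuous chart := continuous_rayOf.comp (continuous_hemisphereChart.subtype_mk _)
  have hinj : Function.Injective chart := fun y z h => by
    obtain ⟨t, ht, h⟩ := (rayOf_eq_iff _ _).1 h
    exact (eq_of_hemisphereChart_eq_smul hu ht.le h).2.symm
  have hbdd : Bornology.IsBounded (hemisphereChart ℓ u ⁻¹' C) := by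
    refine (Metric.isBounded_ball (x := 0) (r := 1)).subset fun y hy => ?_
    have := hpos _ hy
    rw [apply_hemisphereChart hu] at this
    simpa using this
  have himage : chart '' (hemisphereChart ℓ u ⁻¹' C) = raysOf (C : Set U) := by
    apply Set.Subset.antisymm
    · rintro _ ⟨y, hy, rfl⟩
      exact ⟨_, hy, _, rfl⟩
    · rintro _ ⟨v, hv, hv0, rfl⟩
      obtain ⟨t, ht, y, hy⟩ := exists_hemisphereChart_eq_smul hu (hpos v hv)
      refine ⟨y, ?_, ((rayOf_eq_iff ⟨v, hv0⟩ _).2 ⟨t, ht, hy⟩).symm⟩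
      exact Set.mem_preimage.2 (hy ▸ C.smul_mem ht hv)
  rw [← himage]
  exact isOpenBallCell_image_of_convex (hopen.preimage continuous_hemisphereChart)
    (convex_preimage_hemisphereChart huC) ⟨0, by simpa [hemisphereChart] using huC⟩ hbdd hchart hinj

theorem isOpenBallCell_raysOf [FiniteDimensional ℝ U] {C : ConvexCone ℝ U} (M : Submodule ℝ U)
    (hCM : (C : Set U) ⊆ M) (hopen : IsOpen ((↑) ⁻¹' (C : Set U) : Set M)) (hblunt : C.Blunt)
    (hne : (C : Set U).Nonempty) : IsOpenBallCell (raysOf (C : Set U)) := by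
  have himage : M.subtype '' (C.comap M.subtype) = (C : Set U) := by
    simpa [Set.image_preimage_eq_iff] using hCM
  obtain ⟨v, hv⟩ := hne
  have hcell : IsOpenBallCell (raysOf (C.comap M.subtype : Set M)) :=
    isOpenBallCell_raysOf_of_isOpen hopen hblunt ⟨⟨v, hCM hv⟩, hv⟩
  rw [← himage, raysOf_image _ M.injective_subtype]
  exact hcell.image (isClosedEmbedding_rayMap M.subtype M.injective_subtype)

end OpenCones

section Lexicographic

variable {E : Type*} [AddCommGroup E] [Module ℝ E] {B ι : Type*} [LinearOrder ι]
  {f : B → ι → E →ₗ[ℝ] ℝ} {x y : E}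

/-- The pairs `(b, i)` such that the sequence of forms `f b` vanishes at `x` before the index `i`
and is non-negative there. The sets `lexNonneg f x` classify the points `x` by the lexicographic
signs of all the sequences `f b`. -/
def lexNonneg (f : B → ι → E →ₗ[ℝ] ℝ) (x : E) : Set (B × ι) :=
  {p | (∀ j < p.2, f p.1 j x = 0) ∧ 0 ≤ f p.1 p.2 x}

/-- A family of sequences of forms which is stable under negation. -/
def IsSymmetricFamily (f : B → ι → E →ₗ[ℝ] ℝ) : Prop := ∀ b, ∃ b', f b' = -f b

/-- The subspace cut out by the forms `f b i` such that the sequence `f b` vanishes at `x` up to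
and including the index `i`; it is the linear hull of the face of `x`, see `span_cell_face`. -/
def lexSpan (f : B → ι → E →ₗ[ℝ] ℝ) (x : E) : Submodule ℝ E where
  carrier := {y | ∀ b i, (∀ j ≤ i, f b j x = 0) → f b i y = 0}
  add_mem' hy hz b i h := by simp [hy b i h, hz b i h]
  zero_mem' := by simp
  smul_mem' c y hy b i h := by simp [hy b i h]

theorem mem_lexSpan : y ∈ lexSpan f x ↔ ∀ b i, (∀ j ≤ i, f b j x = 0) → f b i y = 0 := Iff.rfl

theorem self_mem_lexSpan (f : B → ι → E →ₗ[ℝ] ℝ) (x : E) : x ∈ lexSpan f x :=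
  fun _ i h => h i le_rfl

theorem lexSpan_mono (h : x ∈ lexSpan f y) : lexSpan f x ≤ lexSpan f y :=
  fun _ hz b i hy => hz b i fun j hj => h b j fun k hk => hy k (hk.trans hj)

theorem lexNonneg_zero (f : B → ι → E →ₗ[ℝ] ℝ) : lexNonneg f 0 = Set.univ := by
  simp [lexNonneg]

namespace IsSymmetricFamily

theorem apply_eq_zero (hf : IsSymmetricFamily f) (h : ∀ p ∈ lexNonneg f y, 0 ≤ f p.1 p.2 x)
    {b : B} {i : ι} (hy : ∀ j ≤ i, f b j y = 0) : f b i x = 0 := by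
  obtain ⟨b', hb'⟩ := hf b
  have hpos : 0 ≤ f b i x := h (b, i) ⟨fun j hj => hy j hj.le, (hy i le_rfl).ge⟩
  have hneg : 0 ≤ f b' i x := h (b', i)
    ⟨fun j hj => by simp [hb', hy j hj.le], by simp [hb', hy i le_rfl]⟩
  simp only [hb', Pi.neg_apply, LinearMap.neg_apply] at hneg
  linarith

theorem lexNonneg_subset_iff (hf : IsSymmetricFamily f) :
    lexNonneg f y ⊆ lexNonneg f x ↔ ∀ p ∈ lexNonneg f y, 0 ≤ f p.1 p.2 x :=
  ⟨fun h _ hp => (h hp).2, fun h p hp => ⟨fun _ hj => hf.apply_eq_zero h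
    fun k hk => hp.1 k (hk.trans_lt hj), h p hp⟩⟩

theorem mem_lexSpan_of_subset (hf : IsSymmetricFamily f) (h : lexNonneg f y ⊆ lexNonneg f x) :
    x ∈ lexSpan f y :=
  fun _ _ hy => hf.apply_eq_zero (hf.lexNonneg_subset_iff.1 h) hy

theorem lexNonneg_subset_of_mem_lexSpan (hf : IsSymmetricFamily f)
    (h : lexNonneg f y ⊆ lexNonneg f x) (hy : y ∈ lexSpan f x) :
    lexNonneg f x ⊆ lexNonneg f y := by
  refine hf.lexNonneg_subset_iff.2 fun ⟨b, i⟩ hp => ?_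
  by_contra! hneg
  obtain ⟨b', hb'⟩ := hf b
  have hy0 : ∀ j < i, f b j y = 0 := fun j hj => hy b j fun k hk => hp.1 k (hk.trans_lt hj)
  have hb'y : (b', i) ∈ lexNonneg f y :=
    ⟨fun j hj => by simp [hb', hy0 j hj], by simpa [hb'] using hneg.le⟩
  have hxi : f b i x = 0 := le_antisymm (by simpa [hb'] using (h hb'y).2) hp.2
  refine hneg.ne (hy b i fun j hj => ?_)
  rcases hj.eq_or_lt with rfl | hj
  exacts [hxi, hp.1 j hj]

theorem lexNonneg_smul_add_smul [WellFoundedLT ι] (hf : IsSymmetricFamily f)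
    (h : lexNonneg f y ⊆ lexNonneg f x) {s t : ℝ} (hs : 0 ≤ s) (ht : 0 < t) :
    lexNonneg f (s • x + t • y) = lexNonneg f y := by
  have hsub : lexNonneg f y ⊆ lexNonneg f (s • x + t • y) := by
    refine hf.lexNonneg_subset_iff.2 fun p hp => ?_
    have hx := (h hp).2
    have hy := hp.2
    simp only [map_add, map_smul, smul_eq_mul]
    positivity
  refine (hf.lexNonneg_subset_of_mem_lexSpan hsub fun b i => ?_).antisymm hsub
  -- By induction, `f b` vanishes at `y` before `i`, so `f b i x` and `f b i y` have the same sign.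
  induction i using WellFoundedLT.induction with
  | ind i ih =>
    intro hsum
    have hy0 : ∀ j < i, f b j y = 0 := fun j hj => ih j hj fun k hk => hsum k (hk.trans hj.le)
    have hi := hsum i le_rfl
    simp only [map_add, map_smul, smul_eq_mul] at hi
    rcases lt_trichotomy (f b i y) 0 with hneg | h0 | hpos
    · obtain ⟨b', hb'⟩ := hf b
      have hx : f b i x ≤ 0 := by
        simpa [hb'] using (@h (b', i) ⟨fun j hj => by simp [hb', hy0 j hj],
          by simpa [hb'] using hneg.le⟩).2
      nlinarith
    · exact h0
    · have hx : 0 ≤ f b i x := (@h (b, i) ⟨hy0, hpos.le⟩).2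
      nlinarith

theorem exists_pos_of_notMem_lexSpan [WellFoundedLT ι] (hf : IsSymmetricFamily f)
    (hy : y ∉ lexSpan f x) : ∃ p ∈ lexNonneg f y, 0 < f p.1 p.2 y ∧ f p.1 p.2 x = 0 := by
  simp only [mem_lexSpan, not_forall] at hy
  obtain ⟨b, i, hx, hi⟩ := hy
  obtain ⟨j, hj, hmin⟩ := WellFounded.has_min (wellFounded_lt (α := ι)) {j | f b j y ≠ 0} ⟨i, hi⟩
  replace hmin : ∀ k < j, f b k y = 0 := fun k hk => not_not.1 fun h => hmin k h hk
  have hxj : f b j x = 0 := hx j (le_of_not_gt fun h => hi (hmin i h))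
  rcases lt_or_gt_of_ne hj with hneg | hpos
  · obtain ⟨b', hb'⟩ := hf b
    exact ⟨(b', j), ⟨fun k hk => by simp [hb', hmin k hk], by simpa [hb'] using hneg.le⟩,
      by simpa [hb'] using hneg, by simpa [hb'] using hxj⟩
  · exact ⟨(b, j), ⟨hmin, hpos.le⟩, hpos, hxj⟩

end IsSymmetricFamily

/-- The faces of `f`, i.e. the classes of points with the same lexicographic signs, encoded by the
sets `lexNonneg f x`. The order is reverse inclusion, so that a face degenerates downwards. -/
def LexFace (f : B → ι → E →ₗ[ℝ] ℝ) : Type _ := (Set.range (lexNonneg f))ᵒᵈ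

instance : PartialOrder (LexFace f) :=
  inferInstanceAs (PartialOrder (Set.range (lexNonneg f))ᵒᵈ)

instance [Finite B] [Finite ι] : Finite (LexFace f) :=
  inferInstanceAs (Finite (Set.range (lexNonneg f)))

/-- The face containing `x`. -/
def face (f : B → ι → E →ₗ[ℝ] ℝ) (x : E) : LexFace f := OrderDual.toDual ⟨_, x, rfl⟩

theorem face_surjective (f : B → ι → E →ₗ[ℝ] ℝ) : Function.Surjective (face f) :=
  fun ⟨_, x, h⟩ => ⟨x, Subtype.ext h⟩

theorem face_le_face_iff : face f x ≤ face f y ↔ lexNonneg f y ⊆ lexNonneg f x := Iff.rfl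

theorem face_eq_face_iff : face f x = face f y ↔ lexNonneg f x = lexNonneg f y :=
  Subtype.ext_iff

instance : OrderBot (LexFace f) where
  bot := face f 0
  bot_le F := by
    obtain ⟨x, rfl⟩ := face_surjective f F
    exact face_le_face_iff.2 (lexNonneg_zero f ▸ Set.subset_univ _)

theorem face_zero (f : B → ι → E →ₗ[ℝ] ℝ) : face f 0 = ⊥ := rfl

theorem face_eq_bot_iff (hf : IsSymmetricFamily f) (hsep : ∀ x, (∀ b i, f b i x = 0) → x = 0) :
    face f x = ⊥ ↔ x = 0 := by
  refine ⟨fun h => hsep x fun b i => ?_, fun h => h ▸ face_zero f⟩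
  exact hf.mem_lexSpan_of_subset (face_le_face_iff.1 h.le) b i fun _ _ => map_zero _

theorem IsSymmetricFamily.lexSpan_lt_lexSpan (hf : IsSymmetricFamily f)
    (h : face f x < face f y) : lexSpan f x < lexSpan f y :=
  (lexSpan_mono (hf.mem_lexSpan_of_subset h.le)).lt_of_not_ge fun hle =>
    h.not_ge (hf.lexNonneg_subset_of_mem_lexSpan h.le (hle (self_mem_lexSpan f y)))

/-- The points of a face. -/
def LexFace.cell (F : LexFace f) : Set E := {x | face f x = F}

theorem LexFace.mem_cell {F : LexFace f} : x ∈ F.cell ↔ face f x = F := Iff.rfl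

theorem IsSymmetricFamily.cell_face_subset_lexSpan (hf : IsSymmetricFamily f) (x : E) :
    (face f x).cell ⊆ lexSpan f x := fun _ hz =>
  hf.mem_lexSpan_of_subset (face_eq_face_iff.1 hz).ge

/-- The points of a face form a convex cone. -/
def LexFace.cone [WellFoundedLT ι] (hf : IsSymmetricFamily f) (F : LexFace f) :
    ConvexCone ℝ E where
  carrier := F.cell
  smul_mem' t ht x hx := by
    rw [LexFace.mem_cell, ← LexFace.mem_cell.1 hx, face_eq_face_iff]
    simpa using hf.lexNonneg_smul_add_smul (subset_refl (lexNonneg f x)) le_rfl ht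
  add_mem' x hx y hy := by
    rw [LexFace.mem_cell, ← LexFace.mem_cell.1 hy, face_eq_face_iff]
    simpa using hf.lexNonneg_smul_add_smul (face_le_face_iff.1 (hx.trans hy.symm).le)
      zero_le_one one_pos

theorem LexFace.smul_mem_cell [WellFoundedLT ι] (hf : IsSymmetricFamily f) (F : LexFace f)
    ⦃t : ℝ⦄ (ht : 0 < t) ⦃x : E⦄ (hx : x ∈ F.cell) : t • x ∈ F.cell :=
  (F.cone hf).smul_mem ht hx

end Lexicographic

section LexTopology

open Filter Topology

variable {E : Type*} [NormedAddCommGroup E] [NormedSpace ℝ E] {B ι : Type*} [LinearOrder ι]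
  {f : B → ι → E →ₗ[ℝ] ℝ} {x y : E}

theorem tendsto_add_smul (x v : E) : Tendsto (fun ε : ℝ => x + ε • v) (𝓝 0) (𝓝 x) := by
  have h : Continuous fun ε : ℝ => x + ε • v := by fun_prop
  simpa using h.tendsto 0

theorem IsSymmetricFamily.rayOf_mem_raysOf_cell [WellFoundedLT ι] (hf : IsSymmetricFamily f)
    {F : LexFace f} (v : {v : E // v ≠ 0}) : rayOf v ∈ raysOf F.cell ↔ face f v.1 = F :=
  rayOf_mem_raysOf (F.smul_mem_cell hf) v

variable [FiniteDimensional ℝ E] [Finite B] [Finite ι]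

theorem eventually_lexNonneg_subset (f : B → ι → E →ₗ[ℝ] ℝ) (x : E) :
    ∀ᶠ z in 𝓝 x, lexNonneg f z ⊆ lexNonneg f x := by
  have hcont : ∀ b i, ContinuousAt (f b i) x := fun b i =>
    (f b i).continuous_of_finiteDimensional.continuousAt
  have hp : ∀ p : B × ι, ∀ᶠ z in 𝓝 x, p ∈ lexNonneg f z → p ∈ lexNonneg f x := by
    intro p
    by_cases hpx : p ∈ lexNonneg f x
    · exact Eventually.of_forall fun _ _ => hpx
    by_cases h0 : ∀ j < p.2, f p.1 j x = 0
    · have hneg : f p.1 p.2 x < 0 := not_le.1 fun h => hpx ⟨h0, h⟩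
      filter_upwards [(hcont _ _).eventually_lt_const hneg] with z hz hpz
      exact absurd hpz.2 hz.not_ge
    · push Not at h0
      obtain ⟨j, hj, hne⟩ := h0
      filter_upwards [(hcont _ _).eventually_ne hne] with z hz hpz
      exact absurd (hpz.1 j hj) hz
  filter_upwards [eventually_all.2 hp] with z hz p using hz p

namespace IsSymmetricFamily

theorem mem_closure_cell_iff (hf : IsSymmetricFamily f) {F : LexFace f} :
    x ∈ closure F.cell ↔ face f x ≤ F := by
  constructor
  · intro hx
    obtain ⟨z, rfl, hz⟩ :=
      ((mem_closure_iff_frequently.1 hx).and_eventually (eventually_lexNonneg_subset f x)).exists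
    exact hz
  · obtain ⟨y, rfl⟩ := face_surjective f F
    intro h
    refine mem_closure_of_tendsto ((tendsto_add_smul x y).mono_left nhdsWithin_le_nhds)
      (eventually_mem_nhdsWithin.mono fun ε (hε : ε ∈ Set.Ioi 0) => face_eq_face_iff.2 ?_)
    simpa using hf.lexNonneg_smul_add_smul (face_le_face_iff.1 h) zero_le_one hε

theorem closure_cell_subset_iff (hf : IsSymmetricFamily f) {F G : LexFace f} :
    closure F.cell ⊆ closure G.cell ↔ F ≤ G := by
  obtain ⟨x, rfl⟩ := face_surjective f F
  exact ⟨fun h => hf.mem_closure_cell_iff.1 (h (subset_closure rfl)), fun h _ hz =>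
    hf.mem_closure_cell_iff.2 ((hf.mem_closure_cell_iff.1 hz).trans h)⟩

theorem eventually_face_eq (hf : IsSymmetricFamily f) (x : E) :
    ∀ᶠ z in 𝓝 x, z ∈ lexSpan f x → face f z = face f x := by
  filter_upwards [eventually_lexNonneg_subset f x] with z hz hzx
  exact face_eq_face_iff.2 (hz.antisymm (hf.lexNonneg_subset_of_mem_lexSpan hz hzx))

theorem isOpen_cell_face (hf : IsSymmetricFamily f) (x : E) :
    IsOpen ((↑) ⁻¹' (face f x).cell : Set (lexSpan f x)) := by
  refine isOpen_iff_mem_nhds.2 fun z hz => ?_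
  have hxz : x ∈ lexSpan f (z : E) := hf.mem_lexSpan_of_subset (face_eq_face_iff.1 hz).le
  filter_upwards [continuous_subtype_val.continuousAt.eventually (hf.eventually_face_eq (z : E))]
    with w hw
  exact (hw (lexSpan_mono hxz w.2)).trans hz

theorem span_cell_face (hf : IsSymmetricFamily f) (x : E) :
    Submodule.span ℝ (face f x).cell = lexSpan f x := by
  refine (Submodule.span_le.2 (hf.cell_face_subset_lexSpan x)).antisymm fun y hy => ?_
  have hev : ∀ᶠ ε in 𝓝[>] (0 : ℝ), face f (x + ε • y) = face f x :=
    (((tendsto_add_smul x y).mono_left nhdsWithin_le_nhds).eventually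
      (hf.eventually_face_eq x)).mono fun ε h =>
        h (add_mem (self_mem_lexSpan f x) (Submodule.smul_mem _ _ hy))
  obtain ⟨ε, hface, hε : 0 < ε⟩ := (hev.and eventually_mem_nhdsWithin).exists
  have hεy : ε • y ∈ Submodule.span ℝ (face f x).cell := by
    simpa using sub_mem (Submodule.subset_span (LexFace.mem_cell.2 hface))
      (Submodule.subset_span (LexFace.mem_cell.2 (rfl : face f x = face f x)))
  exact (Submodule.smul_mem_iff _ hε.ne').1 hεy

end IsSymmetricFamily

/-- The cell complex of the non-minimal faces of `f` in the space of rays. -/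
def rayCells (f : B → ι → E →ₗ[ℝ] ℝ) : Set (Set (RaySpace E)) :=
  {c | ∃ F : LexFace f, F ≠ ⊥ ∧ c = raysOf F.cell}

namespace IsSymmetricFamily

variable (hf : IsSymmetricFamily f) (hsep : ∀ x, (∀ b i, f b i x = 0) → x = 0)

include hf

theorem rayOf_mem_closure_raysOf_cell {F : LexFace f} (v : {v : E // v ≠ 0}) :
    rayOf v ∈ closure (raysOf F.cell) ↔ face f v.1 ≤ F := by
  rw [closure_raysOf (F.smul_mem_cell hf), ← hf.mem_closure_cell_iff]
  exact rayOf_mem_raysOf (fun t ht x hx => map_mem_closure (continuous_const_smul t) hx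
    fun y hy => F.smul_mem_cell hf ht hy) v

theorem isOpenBallCell_raysOf_cell {F : LexFace f} (hF : F ≠ ⊥) :
    IsOpenBallCell (raysOf F.cell) := by
  obtain ⟨x, rfl⟩ := face_surjective f F
  exact isOpenBallCell_raysOf (C := (face f x).cone hf) (lexSpan f x)
    (hf.cell_face_subset_lexSpan x) (hf.isOpen_cell_face x) (fun h => hF (Eq.symm h)) ⟨x, rfl⟩

theorem closure_raysOf_cell_subset_iff {F G : LexFace f} (hF : F ≠ ⊥) :
    closure (raysOf F.cell) ⊆ closure (raysOf G.cell) ↔ F ≤ G := by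
  constructor
  · obtain ⟨x, rfl⟩ := face_surjective f F
    have hx : x ≠ 0 := fun h => hF (h ▸ face_zero f)
    exact fun h => (hf.rayOf_mem_closure_raysOf_cell ⟨x, hx⟩).1
      (h ((hf.rayOf_mem_closure_raysOf_cell ⟨x, hx⟩).2 le_rfl))
  · intro hFG r hr
    obtain ⟨v, rfl⟩ := rayOf_surjective r
    rw [hf.rayOf_mem_closure_raysOf_cell] at hr ⊢
    exact hr.trans hFG

include hsep in
theorem isRegularCellDecomposition_rayCells : IsRegularCellDecomposition (rayCells f) where
  t2 := inferInstance
  finite := (Set.finite_range fun F : LexFace f => raysOf F.cell).subset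
    fun c ⟨F, _, h⟩ => ⟨F, h.symm⟩
  pairwiseDisjoint := by
    rintro _ ⟨F, -, rfl⟩ _ ⟨G, -, rfl⟩ hne
    refine Set.disjoint_left.2 fun r hF hG => hne ?_
    obtain ⟨v, rfl⟩ := rayOf_surjective r
    rw [← (hf.rayOf_mem_raysOf_cell v).1 hF, ← (hf.rayOf_mem_raysOf_cell v).1 hG]
  sUnion_eq := by
    refine Set.eq_univ_of_forall fun r => ?_
    obtain ⟨v, rfl⟩ := rayOf_surjective r
    exact ⟨_, ⟨face f v.1, mt (face_eq_bot_iff hf hsep).1 v.2, rfl⟩,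
      (hf.rayOf_mem_raysOf_cell v).2 rfl⟩
  isBall := by
    rintro _ ⟨F, hF, rfl⟩
    exact hf.isOpenBallCell_raysOf_cell hF
  boundary := by
    rintro _ ⟨F, -, rfl⟩
    refine ⟨{c | ∃ G : LexFace f, G ≠ ⊥ ∧ G < F ∧ c = raysOf G.cell},
      fun c ⟨G, hG, _, h⟩ => ⟨G, hG, h⟩, Set.ext fun r => ?_⟩
    obtain ⟨v, rfl⟩ := rayOf_surjective r
    rw [Set.mem_sdiff, hf.rayOf_mem_closure_raysOf_cell, hf.rayOf_mem_raysOf_cell, Set.mem_iUnion₂,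
      ← lt_iff_le_and_ne]
    constructor
    · exact fun h => ⟨_, ⟨_, mt (face_eq_bot_iff hf hsep).1 v.2, h, rfl⟩,
        (hf.rayOf_mem_closure_raysOf_cell v).2 le_rfl⟩
    · rintro ⟨_, ⟨G, -, hG, rfl⟩, hv⟩
      exact ((hf.rayOf_mem_closure_raysOf_cell v).1 hv).trans_lt hG

/-- The non-minimal faces, as the face poset of `rayCells f`. -/
def facePosetIso : {F : LexFace f // F ≠ ⊥} ≃o FacePoset (rayCells f) :=
  RelIso.ofSurjective
    (OrderEmbedding.ofMapLEIff
      (fun F => (⟨closure (raysOf F.1.cell), _, ⟨F.1, F.2, rfl⟩, rfl⟩ : FacePoset (rayCells f)))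
      fun F _ => hf.closure_raysOf_cell_subset_iff F.2)
    fun ⟨_, _, ⟨F, hF, he⟩, hc⟩ => ⟨⟨F, hF⟩, Subtype.ext ((congrArg closure he).symm.trans hc.symm)⟩

end IsSymmetricFamily

end LexTopology

section GradedPosets

variable {P : Type*} [PartialOrder P]

theorem image_grade_flag [BoundedOrder P] [GradeMinOrder ℕ P] (s : Flag P) :
    grade ℕ '' (s : Set P) = Set.Iic (grade ℕ (⊤ : P)) := by
  refine Set.Subset.antisymm (Set.image_subset_iff.2 fun a _ =>
    grade_mono (𝕆 := ℕ) (le_top (a := a))) fun k hk => ?_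
  induction k with
  | zero => exact ⟨⊥, s.bot_mem, grade_bot⟩
  | succ k ih =>
    obtain ⟨a, ha, rfl⟩ := ih (Nat.le_of_succ_le hk)
    have hmax : ¬IsMax (⟨a, ha⟩ : s) := by
      rw [Flag.isMax_coe.symm, isMax_iff_eq_top]
      rintro rfl
      exact Nat.not_succ_le_self _ hk
    obtain ⟨b, hb⟩ := exists_covBy_of_wellFoundedLT hmax
    exact ⟨b, b.2, (Nat.covBy_iff_add_one_eq.1 (hb.grade ℕ)).symm⟩

theorem encard_flag [BoundedOrder P] [GradeMinOrder ℕ P] (s : Flag P) :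
    (s : Set P).encard = (Set.Iic (grade ℕ (⊤ : P))).encard := by
  have hinj : Set.InjOn (grade ℕ) (s : Set P) := fun a ha b hb hab => by
    rcases s.le_or_le ha hb with h | h
    · exact h.eq_of_not_lt fun hlt => (grade_strictMono hlt).ne hab
    · exact (h.eq_of_not_lt fun hlt => (grade_strictMono hlt).ne' hab).symm
  rw [← image_grade_flag s, hinj.encard_image]

theorem isGradedPoset_of_gradeMinOrder [BoundedOrder P] [GradeMinOrder ℕ P] : IsGradedPoset P :=
  ⟨fun _ _ => le_antisymm, ⟨⊥, fun _ => bot_le⟩, ⟨⊤, fun _ => le_top⟩, fun C D hC hD =>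
    (encard_flag (Flag.ofIsMaxChain C hC)).trans (encard_flag (Flag.ofIsMaxChain D hD)).symm⟩

/-- The grading of a finite graded poset extends to the poset with a maximum adjoined, if all
maximal elements have the same grade. -/
abbrev gradeMinOrderWithTop [OrderBot P] [Finite P] [GradeMinOrder ℕ P] {N : ℕ}
    (hmax : ∀ a : P, IsMax a → grade ℕ a = N) : GradeMinOrder ℕ (WithTop P) where
  grade := WithTop.recTopCoe (N + 1) (grade ℕ)
  grade_strictMono a b hab := by
    have hle : ∀ a : P, grade ℕ a ≤ N := fun a => by
      obtain ⟨b, hab, hb⟩ := Finite.exists_le_maximal (p := fun _ : P => True) (a := a) trivial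
      exact (grade_mono hab).trans_eq (hmax b (maximal_true.1 hb))
    induction a with
    | top => exact absurd hab not_top_lt
    | coe a =>
      induction b with
      | top => exact Nat.lt_succ_of_le (hle a)
      | coe b => exact grade_strictMono (WithTop.coe_lt_coe.1 hab)
  covBy_grade a b hab := by
    induction a with
    | top => exact absurd hab.lt not_top_lt
    | coe a =>
      induction b with
      | top =>
        exact Nat.covBy_iff_add_one_eq.2 (congrArg (· + 1) (hmax a (WithTop.coe_covBy_top.1 hab)))
      | coe b => exact (WithTop.coe_covBy_coe.1 hab).grade ℕ
  isMin_grade a ha := by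
    rw [isMin_iff_eq_bot.1 ha, ← WithTop.coe_bot]
    exact (isMin_bot : IsMin (⊥ : P)).grade ℕ

theorem IsGradedPoset.of_orderIso {P Q : Type*} [Preorder P] [Preorder Q] (e : P ≃o Q)
    (h : IsGradedPoset P) : IsGradedPoset Q := by
  obtain ⟨hanti, ⟨a, ha⟩, ⟨b, hb⟩, hchain⟩ := h
  refine ⟨fun x y hxy hyx => e.symm.injective (hanti _ _ (e.symm.monotone hxy)
    (e.symm.monotone hyx)), ⟨e a, fun x => e.le_symm_apply.1 (ha _)⟩,
    ⟨e b, fun x => e.symm_apply_le.1 (hb _)⟩, fun C D hC hD => ?_⟩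
  rw [← e.symm.injective.encard_image C, ← e.symm.injective.encard_image D]
  exact hchain _ _ (hC.image e.symm) (hD.image e.symm)

end GradedPosets

section LexGrading

open Filter Topology

variable {E : Type*} [NormedAddCommGroup E] [NormedSpace ℝ E] [FiniteDimensional ℝ E]
  {B ι : Type*} [Finite B] [Finite ι] [LinearOrder ι] {f : B → ι → E →ₗ[ℝ] ℝ} {x y v : E}

namespace IsSymmetricFamily

theorem eventually_subset_lexNonneg_add_smul (hf : IsSymmetricFamily f)
    (hyx : lexNonneg f y ⊆ lexNonneg f x) (hv : v ∈ lexSpan f y)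
    (hpos : ∀ p ∈ lexNonneg f y, 0 < f p.1 p.2 y → f p.1 p.2 x = 0 → 0 ≤ f p.1 p.2 v) :
    ∀ᶠ ε in 𝓝[>] (0 : ℝ), lexNonneg f y ⊆ lexNonneg f (x + ε • v) := by
  have hp : ∀ p : B × ι, ∀ᶠ ε in 𝓝[>] (0 : ℝ), p ∈ lexNonneg f y → 0 ≤ f p.1 p.2 (x + ε • v) := by
    intro p
    by_cases hpy : p ∈ lexNonneg f y
    swap
    · exact Eventually.of_forall fun _ h => absurd h hpy
    rcases (hyx hpy).2.eq_or_lt with hx | hx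
    · refine eventually_mem_nhdsWithin.mono fun ε (hε : 0 < ε) _ => ?_
      rcases hpy.2.eq_or_lt with hy | hy
      · have hv0 : f p.1 p.2 v = 0 := hv p.1 p.2 fun j hj =>
          hj.eq_or_lt.elim (fun h => h ▸ hy.symm) (hpy.1 j)
        simp [← hx, hv0]
      · have := hpos p hpy hy hx.symm
        simp only [map_add, ← hx, map_smul, smul_eq_mul, zero_add]
        positivity
    · have hlim := ((f p.1 p.2).continuous_of_finiteDimensional.tendsto x).comp
        ((tendsto_add_smul x v).mono_left (nhdsWithin_le_nhds (s := Set.Ioi 0)))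
      exact (hlim.eventually_const_lt hx).mono fun ε h _ => h.le
  filter_upwards [eventually_all.2 hp] with ε hε using hf.lexNonneg_subset_iff.2 hε

omit [FiniteDimensional ℝ E] in
theorem exists_sub_smul_nonneg (hf : IsSymmetricFamily f) (hxy : y ∉ lexSpan f x) (u : E) :
    ∃ s : ℝ, (∀ p ∈ lexNonneg f y, 0 < f p.1 p.2 y → f p.1 p.2 x = 0 →
        0 ≤ f p.1 p.2 (u - s • y)) ∧
      ∃ p ∈ lexNonneg f y, 0 < f p.1 p.2 y ∧ f p.1 p.2 x = 0 ∧ f p.1 p.2 (u - s • y) = 0 := by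
  let A : Set (B × ι) := {p | p ∈ lexNonneg f y ∧ 0 < f p.1 p.2 y ∧ f p.1 p.2 x = 0}
  obtain ⟨p, ⟨hp, hpy, hpx⟩, hmin⟩ := Set.exists_min_image A
    (fun p => f p.1 p.2 u / f p.1 p.2 y) A.toFinite (hf.exists_pos_of_notMem_lexSpan hxy)
  refine ⟨f p.1 p.2 u / f p.1 p.2 y, fun q hq hqy hqx => ?_, p, hp, hpy, hpx, ?_⟩
  · simpa [le_div_iff₀ hqy] using hmin q ⟨hq, hqy, hqx⟩
  · simp [div_mul_cancel₀ _ hpy.ne']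

theorem exists_face_between (hf : IsSymmetricFamily f) (hxy : face f x < face f y) {u : E}
    (hu : u ∈ lexSpan f y) (hu' : u ∉ lexSpan f x ⊔ Submodule.span ℝ {y}) :
    ∃ z, face f x < face f z ∧ face f z < face f y := by
  have hyx : y ∉ lexSpan f x := fun h =>
    hxy.not_ge (hf.lexNonneg_subset_of_mem_lexSpan hxy.le h)
  obtain ⟨s, hpos, p, hp, hpy, hpx, hpv⟩ := hf.exists_sub_smul_nonneg hyx u
  have hv : u - s • y ∈ lexSpan f y :=
    sub_mem hu (Submodule.smul_mem _ _ (self_mem_lexSpan f y))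
  have hv' : u - s • y ∉ lexSpan f x := fun h => hu' <| Submodule.mem_sup.2
    ⟨_, h, s • y, Submodule.mem_span_singleton.2 ⟨s, rfl⟩, sub_add_cancel _ _⟩
  have hlower : ∀ᶠ ε in 𝓝[>] (0 : ℝ), lexNonneg f (x + ε • (u - s • y)) ⊆ lexNonneg f x :=
    ((tendsto_add_smul x _).mono_left nhdsWithin_le_nhds).eventually
      (eventually_lexNonneg_subset f x)
  obtain ⟨ε, ⟨hzx, hyz⟩, hε : 0 < ε⟩ := ((hlower.and
    (hf.eventually_subset_lexNonneg_add_smul hxy.le hv hpos)).and eventually_mem_nhdsWithin).exists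
  refine ⟨x + ε • (u - s • y), lt_of_le_not_ge hzx fun h => hv' ?_,
    lt_of_le_not_ge hyz fun h => hpy.ne' ?_⟩
  · have hεv : ε • (u - s • y) ∈ lexSpan f x := by
      simpa using sub_mem (hf.mem_lexSpan_of_subset h) (self_mem_lexSpan f x)
    exact (Submodule.smul_mem_iff _ hε.ne').1 hεv
  · refine hf.mem_lexSpan_of_subset h p.1 p.2 fun j hj => ?_
    rcases hj.eq_or_lt with rfl | hj
    · simp [hpx, hpv]
    · exact ((hyz hp).1 j hj)

theorem finrank_lexSpan_of_covBy (hf : IsSymmetricFamily f) (hxy : face f x ⋖ face f y) :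
    Module.finrank ℝ (lexSpan f y) = Module.finrank ℝ (lexSpan f x) + 1 := by
  have hle : lexSpan f y ≤ lexSpan f x ⊔ Submodule.span ℝ {y} := fun u hu => by
    by_contra hu'
    obtain ⟨z, hxz, hzy⟩ := hf.exists_face_between hxy.lt hu hu'
    exact hxy.2 hxz hzy
  have hlt := Submodule.finrank_lt_finrank_of_lt (hf.lexSpan_lt_lexSpan hxy.lt)
  have hsup := (Submodule.finrank_mono hle).trans
    (Submodule.finrank_add_le_finrank_add_finrank _ _)
  have hline := finrank_span_le_card (R := ℝ) ({y} : Set E)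
  rw [Set.toFinset_singleton, Finset.card_singleton] at hline
  omega

theorem lexSpan_eq_top_of_isMax (hf : IsSymmetricFamily f) (hx : IsMax (face f x)) :
    lexSpan f x = ⊤ := by
  refine eq_top_iff.2 fun u _ => ?_
  have hev := ((tendsto_add_smul x u).mono_left (nhdsWithin_le_nhds (s := Set.Ioi 0))).eventually
    (eventually_lexNonneg_subset f x)
  obtain ⟨ε, hsub, hε : 0 < ε⟩ := (hev.and eventually_mem_nhdsWithin).exists
  have hεu : ε • u ∈ lexSpan f x := by
    simpa using sub_mem (hf.mem_lexSpan_of_subset (hx (b := face f (x + ε • u)) hsub))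
      (self_mem_lexSpan f x)
  exact (Submodule.smul_mem_iff _ hε.ne').1 hεu

variable (hf : IsSymmetricFamily f) (hsep : ∀ x, (∀ b i, f b i x = 0) → x = 0)

include hf in
theorem finrank_span_cell_of_isMax {F : LexFace f} (hF : IsMax F) :
    Module.finrank ℝ (Submodule.span ℝ F.cell) = Module.finrank ℝ E := by
  obtain ⟨x, rfl⟩ := face_surjective f F
  rw [hf.span_cell_face, hf.lexSpan_eq_top_of_isMax hF, finrank_top]

include hsep in
/-- The faces of a separating family are graded by the dimensions of their linear hulls. -/
abbrev gradeMinOrder : GradeMinOrder ℕ (LexFace f) where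
  grade F := Module.finrank ℝ (Submodule.span ℝ F.cell)
  grade_strictMono F G hFG := by
    obtain ⟨x, rfl⟩ := face_surjective f F
    obtain ⟨y, rfl⟩ := face_surjective f G
    beta_reduce
    rw [hf.span_cell_face, hf.span_cell_face]
    exact Submodule.finrank_lt_finrank_of_lt (hf.lexSpan_lt_lexSpan hFG)
  covBy_grade F G hFG := by
    obtain ⟨x, rfl⟩ := face_surjective f F
    obtain ⟨y, rfl⟩ := face_surjective f G
    rw [hf.span_cell_face, hf.span_cell_face]
    exact Nat.covBy_iff_add_one_eq.2 (hf.finrank_lexSpan_of_covBy hFG).symm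
  isMin_grade F hF := by
    have hspan : lexSpan f 0 = ⊥ := (Submodule.eq_bot_iff _).2 fun y hy =>
      hsep y fun b i => hy b i fun _ _ => map_zero _
    rw [isMin_iff_eq_bot.1 hF, ← face_zero, hf.span_cell_face, hspan, finrank_bot]
    exact isMin_bot

include hf hsep in
theorem isGradedPoset_withTop_lexFace : IsGradedPoset (WithTop (LexFace f)) :=
  let _ := hf.gradeMinOrder hsep
  let _ := gradeMinOrderWithTop (P := LexFace f) fun _ => hf.finrank_span_cell_of_isMax
  isGradedPoset_of_gradeMinOrder

end IsSymmetricFamily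

end LexGrading

section Transport

variable {T T' : Type*} [TopologicalSpace T] [TopologicalSpace T']

theorem IsRegularCellDecomposition.image {E : Set (Set T)} (hE : IsRegularCellDecomposition E)
    (φ : T ≃ₜ T') : IsRegularCellDecomposition (Set.image φ '' E) where
  t2 :=
    have := hE.t2
    φ.t2Space
  finite := hE.finite.image _
  pairwiseDisjoint := by
    rintro _ ⟨e, he, rfl⟩ _ ⟨e', he', rfl⟩ hne
    exact (Set.disjoint_image_iff φ.injective).2
      (hE.pairwiseDisjoint he he' fun h => hne (congrArg _ h))
  sUnion_eq := by
    rw [← Set.image_sUnion, hE.sUnion_eq, Set.image_univ, φ.surjective.range_eq]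
  isBall := by
    rintro _ ⟨e, he, rfl⟩
    exact IsOpenBallCell.image (hE.isBall e he) φ.isClosedEmbedding
  boundary := by
    rintro _ ⟨e, he, rfl⟩
    obtain ⟨A, hA, h⟩ := hE.boundary e he
    refine ⟨Set.image φ '' A, Set.image_mono hA, ?_⟩
    rw [← φ.image_closure, ← Set.image_sdiff φ.injective, h, Set.image_iUnion₂, Set.biUnion_image]
    simp only [φ.image_closure]

/-- The face poset is invariant under homeomorphisms. -/
def facePosetImage (E : Set (Set T)) (φ : T ≃ₜ T') :
    FacePoset E ≃o FacePoset (Set.image φ '' E) where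
  toFun c := ⟨φ '' c.1, by
    obtain ⟨e, he, hc⟩ := c.2
    exact ⟨φ '' e, ⟨e, he, rfl⟩, by rw [hc, φ.image_closure]⟩⟩
  invFun c := ⟨φ ⁻¹' c.1, by
    obtain ⟨_, ⟨e, he, rfl⟩, hc⟩ := c.2
    exact ⟨e, he, by rw [hc, ← φ.image_closure, φ.injective.preimage_image]⟩⟩
  left_inv c := Subtype.ext (φ.injective.preimage_image _)
  right_inv c := Subtype.ext (φ.surjective.image_preimage _)
  map_rel_iff' := Set.image_subset_image_iff φ.injective

end Transport

section Roots

variable {V : Type*} [NormedAddCommGroup V] [InnerProductSpace ℝ V]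

theorem rootRefl_apply (α v : V) : rootRefl α v = v - (2 * (inner ℝ α v / ‖α‖ ^ 2)) • α := by
  rw [rootRefl, Submodule.reflection_orthogonal_apply, Submodule.reflection_singleton_apply]
  simp only [RCLike.ofReal_real_eq_id, id_eq, two_smul, two_mul, add_smul]
  abel

theorem rootRefl_self (α : V) : rootRefl α α = -α :=
  Submodule.reflection_orthogonalComplement_singleton_eq_neg α

theorem rootRefl_rootRefl (α v : V) : rootRefl α (rootRefl α v) = v :=
  Submodule.reflection_reflection _ v

theorem rootRefl_mul_self (α : V) : rootRefl α * rootRefl α = 1 :=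
  LinearIsometryEquiv.ext (rootRefl_rootRefl α)

theorem rootRefl_neg (α : V) : rootRefl (-α) = rootRefl α := by
  ext v
  simp [rootRefl_apply, neg_div]

theorem rootRefl_eq_self {α v : V} (h : inner ℝ α v = 0) : rootRefl α v = v := by
  simp [rootRefl_apply, h]

theorem inner_map_left (w : V ≃ₗᵢ[ℝ] V) (x y : V) : inner ℝ (w x) y = inner ℝ x (w⁻¹ y) :=
  w.inner_map_eq_flip x y

theorem rootRefl_map (w : V ≃ₗᵢ[ℝ] V) (α : V) : rootRefl (w α) = w * rootRefl α * w⁻¹ := by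
  ext v
  change _ = w (rootRefl α (w⁻¹ v))
  rw [rootRefl_apply, rootRefl_apply, inner_map_left, w.norm_map, map_sub, map_smul]
  exact congrArg (· - _) (w.apply_symm_apply v).symm

theorem inner_lt_inner_rootRefl {α ρ v : V} (hρ : 0 < inner ℝ α ρ) (hv : inner ℝ α v < 0) :
    inner ℝ ρ v < inner ℝ ρ (rootRefl α v) := by
  have hα : 0 < ‖α‖ ^ 2 := by
    have : α ≠ 0 := fun h => by simp [h] at hρ
    positivity
  rw [rootRefl_apply, inner_sub_right, real_inner_smul_right, real_inner_comm α ρ]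
  linarith [mul_neg_of_neg_of_pos (div_neg_of_neg_of_pos hv hα) hρ]

theorem inner_eq_zero_of_mem_span {s : Set V} {v : V} (hv : ∀ α ∈ s, inner ℝ α v = 0) {β : V}
    (hβ : β ∈ Submodule.span ℝ s) : inner ℝ β v = 0 :=
  (Submodule.span_le (p := LinearMap.ker ((innerₗ V).flip v))).2 hv hβ

theorem eq_zero_of_mem_span_of_forall_inner_eq_zero {s : Set V} {v : V}
    (hv : v ∈ Submodule.span ℝ s) (h : ∀ α ∈ s, inner ℝ α v = 0) : v = 0 :=
  inner_self_eq_zero.1 (inner_eq_zero_of_mem_span h hv)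

theorem inner_nonneg_of_mem_span {s : Set V} {v : V} (hv : ∀ α ∈ s, 0 ≤ inner ℝ α v) {β : V}
    (hβ : β ∈ Submodule.span ℝ≥0 s) : 0 ≤ inner ℝ β v := by
  induction hβ using Submodule.span_induction with
  | mem α hα => exact hv α hα
  | zero => simp
  | add β γ _ _ ihβ ihγ => exact (add_nonneg ihβ ihγ).trans_eq (inner_add_left β γ v).symm
  | smul c β _ ih =>
    rw [NNReal.smul_def, real_inner_smul_left]
    exact mul_nonneg c.2 ih

theorem mem_span_setOf_inner_eq_zero {s : Set V} {v : V} (hv : ∀ α ∈ s, 0 ≤ inner ℝ α v) {β : V}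
    (hβ : β ∈ Submodule.span ℝ≥0 s) (h : inner ℝ β v = 0) :
    β ∈ Submodule.span ℝ≥0 {α ∈ s | inner ℝ α v = 0} := by
  induction hβ using Submodule.span_induction with
  | mem α hα => exact Submodule.subset_span ⟨hα, h⟩
  | zero => exact zero_mem _
  | add β γ hβ hγ ihβ ihγ =>
    rw [inner_add_left] at h
    have hβ0 := inner_nonneg_of_mem_span hv hβ
    have hγ0 := inner_nonneg_of_mem_span hv hγ
    exact add_mem (ihβ (by linarith)) (ihγ (by linarith))
  | smul c β _ ih =>
    rw [NNReal.smul_def, real_inner_smul_left, mul_eq_zero, NNReal.coe_eq_zero] at h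
    rcases h with rfl | h
    · simp
    · exact Submodule.smul_mem _ _ (ih h)

theorem exists_inner_eq [FiniteDimensional ℝ V] {s : Set V} (hs : LinearIndepOn ℝ id s)
    (g : V → ℝ) : ∃ v : V, ∀ α ∈ s, inner ℝ α v = g α := by
  let b := Module.Basis.extend hs
  let ℓ : V →ₗ[ℝ] ℝ := b.constr ℝ fun α => g α
  refine ⟨(InnerProductSpace.toDual ℝ V).symm (LinearMap.toContinuousLinearMap ℓ), fun α hα => ?_⟩
  rw [real_inner_comm, InnerProductSpace.toDual_symm_apply]
  have hb := b.constr_basis ℝ (fun α => g α) ⟨α, Module.Basis.subset_extend hs hα⟩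
  rwa [Module.Basis.extend_apply_self] at hb

end Roots

section WeylGroup

variable {V : Type*} [NormedAddCommGroup V] [InnerProductSpace ℝ V] {Φ Δ : Set V}
  {w : V ≃ₗᵢ[ℝ] V} {α β : V}

theorem rootRefl_mem_weylGroup (hα : α ∈ Φ) : rootRefl α ∈ weylGroup Φ :=
  Subgroup.subset_closure (Set.mem_image_of_mem _ hα)

namespace IsRootSystem

variable (hΦ : IsRootSystem Φ)
include hΦ

theorem ne_zero (hβ : β ∈ Φ) : β ≠ 0 :=
  fun h => hΦ.zero_notMem (h ▸ hβ)

theorem neg_mem (hβ : β ∈ Φ) : -β ∈ Φ :=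
  rootRefl_self β ▸ hΦ.refl_mem β hβ β hβ

theorem map_mem (hw : w ∈ weylGroup Φ) (hβ : β ∈ Φ) : w β ∈ Φ := by
  induction hw using Subgroup.closure_induction'' generalizing β with
  | mem _ h =>
    obtain ⟨α, hα, rfl⟩ := h
    exact hΦ.refl_mem α hα β hβ
  | inv_mem _ h =>
    obtain ⟨α, hα, rfl⟩ := h
    rw [inv_eq_of_mul_eq_one_left (rootRefl_mul_self α)]
    exact hΦ.refl_mem α hα β hβ
  | one => exact hβ
  | mul _ _ _ _ hx hy => exact hx (hy hβ)

end IsRootSystem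

theorem map_sub_mem_span (hw : w ∈ weylGroup Φ) (v : V) : w v - v ∈ Submodule.span ℝ Φ := by
  induction hw using Subgroup.closure_induction generalizing v with
  | mem _ h =>
    obtain ⟨α, hα, rfl⟩ := h
    rw [rootRefl_apply, sub_sub_cancel_left]
    exact neg_mem (Submodule.smul_mem _ _ (Submodule.subset_span hα))
  | one => simp
  | mul x y _ _ hx hy =>
    have := add_mem (hx (y v)) (hy v)
    rwa [sub_add_sub_cancel] at this
  | inv x _ hx =>
    have := neg_mem (hx (x⁻¹ v))
    rwa [neg_sub, show x (x⁻¹ v) = v from x.apply_symm_apply v] at this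

theorem eq_one_of_forall_root (hw : w ∈ weylGroup Φ) (h : ∀ β ∈ Φ, w β = β) : w = 1 := by
  ext v
  have horth : ∀ β ∈ Φ, inner ℝ β (w v - v) = 0 := fun β hβ => by
    rw [inner_sub_right, sub_eq_zero, ← w.inner_map_map β v, h β hβ]
  exact sub_eq_zero.1 (eq_zero_of_mem_span_of_forall_inner_eq_zero (map_sub_mem_span hw v) horth)

theorem IsRootSystem.finite_weylGroup (hΦ : IsRootSystem Φ) : Finite (weylGroup Φ) := by
  have := hΦ.finite.to_subtype
  refine Finite.of_injective (fun w : weylGroup Φ => fun β : Φ =>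
    (⟨w.1 β.1, hΦ.map_mem w.2 β.2⟩ : Φ)) fun w w' h => ?_
  refine Subtype.ext (inv_mul_eq_one.1 ?_).symm
  refine eq_one_of_forall_root (mul_mem (inv_mem w'.2) w.2) fun β hβ => ?_
  have hβw : w.1 β = w'.1 β := congrArg Subtype.val (congrFun h ⟨β, hβ⟩)
  exact (congrArg w'.1.symm hβw).trans (w'.1.symm_apply_apply β)

namespace IsSimpleSystem

theorem posRoot_or_neg (hΔ : IsSimpleSystem Φ Δ) (hβ : β ∈ Φ) :
    β ∈ posRoots Φ Δ ∨ -β ∈ posRoots Φ Δ := by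
  rw [← hΔ.union_eq] at hβ
  exact hβ

theorem neg_notMem_posRoots (hΔ : IsSimpleSystem Φ Δ) (hβ : β ∈ posRoots Φ Δ) :
    -β ∉ posRoots Φ Δ :=
  fun h => Set.disjoint_left.1 hΔ.disjoint hβ h

theorem mem_posRoots (hΔ : IsSimpleSystem Φ Δ) (hα : α ∈ Δ) : α ∈ posRoots Φ Δ :=
  ⟨hΔ.subset hα, Submodule.subset_span hα⟩

theorem mem_span (hΔ : IsSimpleSystem Φ Δ) (hβ : β ∈ Φ) : β ∈ Submodule.span ℝ Δ := by
  have hspan := Submodule.span_le_restrictScalars ℝ≥0 ℝ Δ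
  rcases hΔ.posRoot_or_neg hβ with h | h
  · exact hspan h.2
  · exact neg_mem_iff.1 (hspan h.2)

theorem posRoot_of_inner_nonneg (hΦ : IsRootSystem Φ) (hΔ : IsSimpleSystem Φ Δ) {ρ : V}
    (hρ : ∀ α ∈ Δ, 0 < inner ℝ α ρ) (hβ : β ∈ Φ) (h : 0 ≤ inner ℝ β ρ) :
    β ∈ posRoots Φ Δ := by
  refine (hΔ.posRoot_or_neg hβ).resolve_right fun hneg => hΦ.ne_zero (hΦ.neg_mem hβ) ?_
  have hρ' : ∀ α ∈ Δ, 0 ≤ inner ℝ α ρ := fun α hα => (hρ α hα).le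
  have hzero : inner ℝ (-β) ρ = 0 :=
    (inner_nonneg_of_mem_span hρ' hneg.2).antisymm' (by simpa [inner_neg_left] using h)
  have hempty : {α ∈ Δ | inner ℝ α ρ = 0} = ∅ :=
    Set.eq_empty_of_forall_notMem fun α hα => (hρ α hα.1).ne' hα.2
  simpa [hempty] using mem_span_setOf_inner_eq_zero hρ' hneg.2 hzero

variable [FiniteDimensional ℝ V]

theorem rootRefl_mem_posRoots (hΦ : IsRootSystem Φ) (hΔ : IsSimpleSystem Φ Δ) (hα : α ∈ Δ)
    (hβ : β ∈ posRoots Φ Δ) (hne : β ≠ α) : rootRefl α β ∈ posRoots Φ Δ := by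
  classical
  refine (hΔ.posRoot_or_neg (hΦ.refl_mem α (hΔ.subset hα) β hβ.1)).resolve_right fun hneg => ?_
  obtain ⟨v, hv⟩ := exists_inner_eq hΔ.linearIndep fun γ => if γ = α then 0 else 1
  have hvα : inner ℝ α v = 0 := by simpa using hv α hα
  have hv0 : ∀ γ ∈ Δ, 0 ≤ inner ℝ γ v := fun γ hγ => by
    rw [hv γ hγ]
    split_ifs <;> norm_num
  have hβv : inner ℝ β v = 0 := by
    have hreflβ := inner_nonneg_of_mem_span hv0 hneg.2
    rw [inner_neg_left, rootRefl_apply, inner_sub_left, real_inner_smul_left, hvα] at hreflβ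
    linarith [inner_nonneg_of_mem_span hv0 hβ.2]
  have hsub : {γ ∈ Δ | inner ℝ γ v = 0} ⊆ {α} := fun γ ⟨hγ, hγv⟩ => by
    simpa [hv γ hγ] using hγv
  obtain ⟨c, rfl⟩ := Submodule.mem_span_singleton.1
    (Submodule.span_mono hsub (mem_span_setOf_inner_eq_zero hv0 hβ.2 hβv))
  rcases hΦ.reduced α (hΔ.subset hα) c hβ.1 with hc | hc
  · exact hne (by rw [NNReal.coe_eq_one.1 hc, one_smul])
  · linarith [c.coe_nonneg]

theorem exists_map_mem (hΦ : IsRootSystem Φ) (hΔ : IsSimpleSystem Φ Δ) (hβ : β ∈ posRoots Φ Δ) :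
    ∃ w ∈ Subgroup.closure (rootRefl '' Δ), w β ∈ Δ := by
  obtain ⟨ρ, hρ⟩ := exists_inner_eq hΔ.linearIndep fun _ => 1
  let orbit : Set V := {γ ∈ posRoots Φ Δ | ∃ w ∈ Subgroup.closure (rootRefl '' Δ), w β = γ}
  have hfin : orbit.Finite := hΦ.finite.subset fun γ hγ => hγ.1.1
  obtain ⟨γ, ⟨hγ, w, hw, hwγ⟩, hmin⟩ := Set.exists_min_image orbit (fun γ => (inner ℝ ρ γ : ℝ)) hfin
    ⟨β, hβ, 1, one_mem _, rfl⟩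
  obtain ⟨α, hα, hαγ⟩ : ∃ α ∈ Δ, 0 < inner ℝ α γ := by
    by_contra! hcon
    have hγγ := inner_nonneg_of_mem_span (v := -γ) (fun α hα => by simpa using hcon α hα) hγ.2
    rw [inner_neg_right, neg_nonneg, real_inner_self_nonpos] at hγγ
    exact hΦ.ne_zero hγ.1 hγγ
  refine ⟨w, hw, ?_⟩
  suffices γ = α by rwa [hwγ, this]
  by_contra hne
  have hα' := Subgroup.subset_closure (Set.mem_image_of_mem rootRefl hα)
  refine (hmin (rootRefl α γ) ⟨hΔ.rootRefl_mem_posRoots hΦ hα hγ hne, rootRefl α * w,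
    mul_mem hα' hw, congrArg (rootRefl α) hwγ⟩).not_gt ?_
  have hlt := inner_lt_inner_rootRefl (v := -γ) ((hρ α hα).symm ▸ one_pos) (by simpa using hαγ)
  simpa using hlt

theorem weylGroup_eq_closure (hΦ : IsRootSystem Φ) (hΔ : IsSimpleSystem Φ Δ) :
    weylGroup Φ = Subgroup.closure (rootRefl '' Δ) := by
  refine le_antisymm ((Subgroup.closure_le _).2 ?_)
    (Subgroup.closure_mono (Set.image_mono hΔ.subset))
  have hpos : ∀ β ∈ posRoots Φ Δ, rootRefl β ∈ Subgroup.closure (rootRefl '' Δ) := fun β hβ => by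
    obtain ⟨w, hw, hwβ⟩ := hΔ.exists_map_mem hΦ hβ
    have hconj : rootRefl β = w⁻¹ * rootRefl (w β) * w := by
      rw [rootRefl_map]
      group
    rw [hconj]
    exact mul_mem (mul_mem (inv_mem hw) (Subgroup.subset_closure (Set.mem_image_of_mem _ hwβ))) hw
  rintro _ ⟨β, hβ, rfl⟩
  rcases hΔ.posRoot_or_neg hβ with h | h
  · exact hpos β h
  · exact rootRefl_neg β ▸ hpos _ h

end IsSimpleSystem

/-- The product `s_{α₁} ⋯ s_{αₖ}` of simple reflections spelled by a word `α₁ … αₖ`. -/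
def wordProd (l : List Δ) : V ≃ₗᵢ[ℝ] V := (l.map fun α : Δ => rootRefl α.1).prod

theorem wordProd_cons (α : Δ) (l : List Δ) :
    wordProd (α :: l) = rootRefl (α : V) * wordProd l := by
  simp [wordProd]

theorem wordProd_append (l l' : List Δ) : wordProd (l ++ l') = wordProd l * wordProd l' := by
  simp [wordProd]

theorem wordProd_singleton (α : Δ) : wordProd [α] = rootRefl (α : V) := by
  simp [wordProd]

theorem wordProd_reverse (l : List Δ) : wordProd l.reverse = (wordProd l)⁻¹ := by
  rw [wordProd, wordProd, List.prod_inv_reverse, List.map_map, List.map_reverse]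
  congr 2

theorem wordProd_mem_weylGroup (h : Δ ⊆ Φ) (l : List Δ) : wordProd l ∈ weylGroup Φ := by
  refine Subgroup.list_prod_mem _ fun w hw => ?_
  obtain ⟨α, -, rfl⟩ := List.mem_map.1 hw
  exact rootRefl_mem_weylGroup (h α.2)

namespace IsSimpleSystem

variable [FiniteDimensional ℝ V] (hΦ : IsRootSystem Φ) (hΔ : IsSimpleSystem Φ Δ)
include hΦ hΔ

theorem exists_wordProd_eq (hw : w ∈ weylGroup Φ) : ∃ l : List Δ, wordProd l = w := by
  rw [hΔ.weylGroup_eq_closure hΦ] at hw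
  induction hw using Subgroup.closure_induction with
  | mem _ h =>
    obtain ⟨α, hα, rfl⟩ := h
    exact ⟨[⟨α, hα⟩], wordProd_singleton _⟩
  | one => exact ⟨[], rfl⟩
  | mul _ _ _ _ hx hy =>
    obtain ⟨l, rfl⟩ := hx
    obtain ⟨l', rfl⟩ := hy
    exact ⟨l ++ l', wordProd_append l l'⟩
  | inv _ _ hx =>
    obtain ⟨l, rfl⟩ := hx
    exact ⟨l.reverse, wordProd_reverse l⟩

theorem exists_wordProd_eq_mul_rootRefl (α : Δ) (l : List Δ)
    (h : -wordProd l (α : V) ∈ posRoots Φ Δ) :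
    ∃ l' : List Δ, l'.length < l.length ∧ wordProd l' = wordProd l * rootRefl (α : V) := by
  induction l with
  | nil => exact absurd h (hΔ.neg_notMem_posRoots (hΔ.mem_posRoots α.2))
  | cons β l ih =>
    rw [wordProd_cons] at h ⊢
    have hα := hΦ.map_mem (wordProd_mem_weylGroup hΔ.subset l) (hΔ.subset α.2)
    rcases hΔ.posRoot_or_neg hα with hpos | hneg
    · have hβ : wordProd l (α : V) = β := by
        by_contra hne
        exact hΔ.neg_notMem_posRoots (hΔ.rootRefl_mem_posRoots hΦ β.2 hpos hne) h
      refine ⟨l, by simp, ?_⟩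
      rw [← hβ, rootRefl_map, inv_mul_cancel_right, mul_assoc, rootRefl_mul_self, mul_one]
    · obtain ⟨l', hlen, hl'⟩ := ih hneg
      exact ⟨β :: l', by simpa using hlen, by rw [wordProd_cons, hl', mul_assoc]⟩

theorem eq_one_of_forall_map_mem_posRoots (hw : w ∈ weylGroup Φ)
    (h : ∀ α ∈ Δ, w α ∈ posRoots Φ Δ) : w = 1 := by
  obtain ⟨l, rfl, hmin⟩ := exists_minimalFor_of_wellFoundedLT (fun l : List Δ => wordProd l = w)
    List.length (hΔ.exists_wordProd_eq hΦ hw)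
  rcases List.eq_nil_or_concat l with rfl | ⟨l, α, rfl⟩
  · rfl
  have hα := h α α.2
  rw [List.concat_eq_append, wordProd_append, wordProd_singleton] at hα hmin
  have hneg : -wordProd l (α : V) ∈ posRoots Φ Δ := by
    simpa [rootRefl_self] using hα
  obtain ⟨l', hlen, hl'⟩ := hΔ.exists_wordProd_eq_mul_rootRefl hΦ α l hneg
  have := hmin hl'
  simp at this
  omega

end IsSimpleSystem

end WeylGroup

section Flags

variable {V : Type*} {Δ : Set V} {n : ℕ} {I : Fin (n + 1) → Set V}

theorem flags_subset (hI : I ∈ flags Δ n) (k : Fin (n + 1)) : I k ⊆ Δ :=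
  hI.1 ▸ hI.2 (Fin.zero_le k)

theorem flags_succ_subset (hI : I ∈ flags Δ n) (i : Fin n) : I i.succ ⊆ I i.castSucc :=
  hI.2 Fin.castSucc_lt_succ.le

theorem forall_castSucc_lt_succ {P : Fin n → Prop} {i : Fin n} :
    (∀ j : Fin n, j.castSucc < i.succ → P j) ↔
      (∀ j : Fin n, j.castSucc < i.castSucc → P j) ∧ P i := by
  simp only [Fin.castSucc_lt_succ_iff, Fin.castSucc_lt_castSucc_iff, le_iff_lt_or_eq, or_imp,
    forall_and, forall_eq]

end Flags

section StdStrata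

variable {V : Type*} [NormedAddCommGroup V] [InnerProductSpace ℝ V] {Φ Δ : Set V} {n : ℕ}
  {I : Fin (n + 1) → Set V} {x y : Fin n → V} {β : V}

/-- The flag whose `k`-th term consists of the elements of `Δ` orthogonal to the first `k` entries
of `x`; it is the flag of the only standard stratum that may contain `x`. -/
def vanishingFlag (Δ : Set V) (x : Fin n → V) (k : Fin (n + 1)) : Set V :=
  {α ∈ Δ | ∀ j : Fin n, j.castSucc < k → inner ℝ α (x j) = 0}

theorem vanishingFlag_mem_flags (Δ : Set V) (x : Fin n → V) : vanishingFlag Δ x ∈ flags Δ n :=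
  ⟨by simp [vanishingFlag], fun _ _ hkl _ hα => ⟨hα.1, fun j hj => hα.2 j (hj.trans_le hkl)⟩⟩

theorem vanishingFlag_succ (Δ : Set V) (x : Fin n → V) (i : Fin n) :
    vanishingFlag Δ x i.succ = {α ∈ vanishingFlag Δ x i.castSucc | inner ℝ α (x i) = 0} := by
  ext α
  simp only [vanishingFlag, Set.mem_ofPred_eq, forall_castSucc_lt_succ, and_assoc]

theorem eq_vanishingFlag_of_mem_stdStratum (hI : I ∈ flags Δ n) (hx : x ∈ stdStratum I) :
    I = vanishingFlag Δ x := by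
  funext k
  induction k using Fin.induction with
  | zero => rw [hI.1, (vanishingFlag_mem_flags Δ x).1]
  | succ i ih =>
    rw [vanishingFlag_succ, ← ih]
    refine Set.Subset.antisymm (fun α hα => ⟨flags_succ_subset hI i hα, (hx i).1 α hα⟩) ?_
    intro α hα
    by_contra hαi
    exact ((hx i).2 α ⟨hα.1, hαi⟩).ne' hα.2

/-- Every element of `Δ` has a non-negative inner product with the first entry of `x` that is not
orthogonal to it; for `n = 1` this is the usual notion of a dominant vector. -/
def IsLexDominant (Δ : Set V) (x : Fin n → V) : Prop :=
  ∀ α ∈ Δ, ∀ i, (∀ j < i, inner ℝ α (x j) = 0) → 0 ≤ inner ℝ α (x i)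

theorem isLexDominant_snoc_iff {v : V} :
    IsLexDominant Δ (Fin.snoc x v : Fin (n + 1) → V) ↔
      IsLexDominant Δ x ∧ ∀ α ∈ vanishingFlag Δ x (Fin.last n), 0 ≤ inner ℝ α v := by
  simp only [IsLexDominant, vanishingFlag, Fin.forall_fin_succ', Fin.snoc_castSucc, Fin.snoc_last,
    Set.mem_ofPred_eq, Fin.castSucc_lt_castSucc_iff, Fin.castSucc_lt_last, (Fin.le_last _).not_gt,
    false_imp_iff, true_imp_iff, and_true, and_imp, imp_and, forall_and]

theorem IsLexDominant.mem_stdStratum (hx : IsLexDominant Δ x) :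
    x ∈ stdStratum (vanishingFlag Δ x) := by
  refine fun i => ⟨fun α hα => hα.2 i Fin.castSucc_lt_succ, fun α ⟨hα, hαi⟩ => ?_⟩
  refine (hx α hα.1 i hα.2).lt_of_ne' fun h => hαi ?_
  rw [vanishingFlag_succ]
  exact ⟨hα, h⟩

theorem exists_isLexDominant [FiniteDimensional ℝ V] (hΦ : IsRootSystem Φ)
    (hΔ : IsSimpleSystem Φ Δ) (x : Fin n → V) :
    ∃ w ∈ weylGroup Φ, IsLexDominant Δ fun i => w (x i) := by
  obtain ⟨ρ, hρ⟩ := exists_inner_eq hΔ.linearIndep fun _ => 1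
  have := hΦ.finite_weylGroup
  obtain ⟨w, hmax⟩ := Finite.exists_max fun w : weylGroup Φ =>
    toLex fun i : Fin n => (inner ℝ ρ (w.1 (x i)) : ℝ)
  refine ⟨w.1, w.2, fun α hα i horth => ?_⟩
  by_contra! hneg
  let s : weylGroup Φ := ⟨rootRefl α, rootRefl_mem_weylGroup (hΔ.subset hα)⟩
  refine (hmax (s * w)).not_gt ⟨i, fun j hj => ?_, ?_⟩
  · exact congrArg (inner ℝ ρ) (rootRefl_eq_self (horth j hj)).symm
  · exact inner_lt_inner_rootRefl ((hρ α hα).symm ▸ one_pos) hneg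

theorem stdStratum_nonempty [FiniteDimensional ℝ V] (hΔ : LinearIndepOn ℝ id Δ)
    (hI : I ∈ flags Δ n) : (stdStratum I).Nonempty := by
  classical
  choose v hv using fun i : Fin n =>
    exists_inner_eq hΔ fun α => if α ∈ I i.succ then 0 else 1
  refine ⟨v, fun i => ⟨fun α hα => ?_, fun α hα => ?_⟩⟩
  · rw [hv i α (flags_subset hI _ hα), if_pos hα]
  · rw [hv i α (flags_subset hI _ hα.1), if_neg hα.2]
    exact one_pos

theorem inner_nonneg_of_mem_stdStratum (hx : x ∈ stdStratum I) {i : Fin n} {α : V}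
    (hα : α ∈ I i.castSucc) : 0 ≤ inner ℝ α (x i) := by
  by_cases h : α ∈ I i.succ
  · exact ((hx i).1 α h).ge
  · exact ((hx i).2 α ⟨hα, h⟩).le

theorem setOf_inner_eq_zero_of_mem_stdStratum (hI : I ∈ flags Δ n) (hx : x ∈ stdStratum I)
    (i : Fin n) : {α ∈ I i.castSucc | inner ℝ α (x i) = 0} = I i.succ := by
  rw [eq_vanishingFlag_of_mem_stdStratum hI hx, vanishingFlag_succ]

theorem forall_inner_eq_zero_iff (hI : I ∈ flags Δ n) (hx : x ∈ stdStratum I)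
    (hβ : β ∈ Submodule.span ℝ≥0 Δ) (k : Fin (n + 1)) :
    (∀ j : Fin n, j.castSucc < k → inner ℝ β (x j) = 0) ↔ β ∈ Submodule.span ℝ≥0 (I k) := by
  induction k using Fin.induction with
  | zero => simpa [hI.1] using hβ
  | succ i ih =>
    rw [forall_castSucc_lt_succ, ih]
    constructor
    · rintro ⟨hβi, hzero⟩
      rw [← setOf_inner_eq_zero_of_mem_stdStratum hI hx]
      exact mem_span_setOf_inner_eq_zero (fun _ => inner_nonneg_of_mem_stdStratum hx) hβi hzero
    · exact fun hβi => ⟨Submodule.span_mono (flags_succ_subset hI i) hβi,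
        inner_eq_zero_of_mem_span (hx i).1 (Submodule.span_le_restrictScalars ℝ≥0 ℝ _ hβi)⟩

theorem inner_nonneg_of_forall_inner_eq_zero (hI : I ∈ flags Δ n) (hx : x ∈ stdStratum I)
    (hβ : β ∈ Submodule.span ℝ≥0 Δ) {i : Fin n} (h : ∀ j < i, inner ℝ β (x j) = 0) :
    0 ≤ inner ℝ β (x i) :=
  inner_nonneg_of_mem_span (fun _ => inner_nonneg_of_mem_stdStratum hx)
    ((forall_inner_eq_zero_iff hI hx hβ i.castSucc).1 h)

end StdStrata

section RootFaces

variable {V : Type*} [NormedAddCommGroup V] [InnerProductSpace ℝ V] {Φ Δ : Set V} {n : ℕ}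
  {I : Fin (n + 1) → Set V} {x y : Fin n → V} {w : V ≃ₗᵢ[ℝ] V}

/-- The sequences of forms `x ↦ ⟪β, x i⟫` on `Vⁿ`, for `β ∈ Φ`. -/
def rootForm (Φ : Set V) (n : ℕ) (β : Φ) (i : Fin n) : (Fin n → V) →ₗ[ℝ] ℝ :=
  innerₗ V β.1 ∘ₗ LinearMap.proj i

theorem rootForm_apply (β : Φ) (i : Fin n) (x : Fin n → V) :
    rootForm Φ n β i x = inner ℝ β.1 (x i) := rfl

theorem isSymmetricFamily_rootForm (hΦ : IsRootSystem Φ) (n : ℕ) :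
    IsSymmetricFamily (rootForm Φ n) := fun β =>
  ⟨⟨-β.1, hΦ.neg_mem β.2⟩, funext fun _ => LinearMap.ext fun _ => inner_neg_left _ _⟩

theorem mem_lexNonneg_of_mem_posRoots_iff (hI : I ∈ flags Δ n) (hx : x ∈ stdStratum I) {β : Φ}
    (hβ : β.1 ∈ posRoots Φ Δ) (i : Fin n) :
    (β, i) ∈ lexNonneg (rootForm Φ n) x ↔ β.1 ∈ Submodule.span ℝ≥0 (I i.castSucc) := by
  rw [← forall_inner_eq_zero_iff hI hx hβ.2]
  exact ⟨fun h => h.1, fun h => ⟨h, inner_nonneg_of_forall_inner_eq_zero hI hx hβ.2 h⟩⟩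

theorem mem_lexNonneg_of_neg_mem_posRoots_iff (hI : I ∈ flags Δ n) (hx : x ∈ stdStratum I) {β : Φ}
    (hβ : -β.1 ∈ posRoots Φ Δ) (i : Fin n) :
    (β, i) ∈ lexNonneg (rootForm Φ n) x ↔ -β.1 ∈ Submodule.span ℝ≥0 (I i.succ) := by
  rw [← forall_inner_eq_zero_iff hI hx hβ.2, forall_castSucc_lt_succ]
  simp only [inner_neg_left, neg_eq_zero]
  refine and_congr_right fun h => ⟨fun hi => le_antisymm ?_ hi, fun hi => hi.ge⟩
  have hneg : ∀ j < i, inner ℝ (-β.1) (x j) = 0 := fun j hj =>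
    (inner_neg_left _ _).trans (neg_eq_zero.2 (h j hj))
  simpa using inner_nonneg_of_forall_inner_eq_zero hI hx hβ.2 hneg

theorem face_eq_face_of_mem_stdStratum (hΔ : IsSimpleSystem Φ Δ) (hI : I ∈ flags Δ n)
    (hx : x ∈ stdStratum I) (hy : y ∈ stdStratum I) :
    face (rootForm Φ n) x = face (rootForm Φ n) y := by
  refine face_eq_face_iff.2 (Set.ext fun ⟨β, i⟩ => ?_)
  rcases hΔ.posRoot_or_neg β.2 with hβ | hβ
  · rw [mem_lexNonneg_of_mem_posRoots_iff hI hx hβ, mem_lexNonneg_of_mem_posRoots_iff hI hy hβ]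
  · rw [mem_lexNonneg_of_neg_mem_posRoots_iff hI hx hβ,
      mem_lexNonneg_of_neg_mem_posRoots_iff hI hy hβ]

theorem inner_eq_zero_of_face_le_face (hΦ : IsRootSystem Φ)
    (h : face (rootForm Φ n) x ≤ face (rootForm Φ n) y) {β : V} (hβ : β ∈ Φ) {i : Fin n}
    (hy : ∀ j ≤ i, inner ℝ β (y j) = 0) : inner ℝ β (x i) = 0 :=
  (isSymmetricFamily_rootForm hΦ n).mem_lexSpan_of_subset (face_le_face_iff.1 h) ⟨β, hβ⟩ i hy

theorem vanishingFlag_subset_of_face_le_face (hΦ : IsRootSystem Φ) (hΔ : Δ ⊆ Φ)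
    (h : face (rootForm Φ n) x ≤ face (rootForm Φ n) y) (k : Fin (n + 1)) :
    vanishingFlag Δ y k ⊆ vanishingFlag Δ x k := fun _ hα =>
  ⟨hα.1, fun _ hj => inner_eq_zero_of_face_le_face hΦ h (hΔ hα.1) fun k hk =>
    hα.2 k ((Fin.castSucc_le_castSucc_iff.2 hk).trans_lt hj)⟩

theorem isLexDominant_of_face_eq (hΦ : IsRootSystem Φ) (hΔ : Δ ⊆ Φ) (hx : IsLexDominant Δ x)
    (h : face (rootForm Φ n) x = face (rootForm Φ n) y) : IsLexDominant Δ y := by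
  intro α hα i hzero
  have hxzero : ∀ j < i, inner ℝ α (x j) = 0 := fun j hj =>
    inner_eq_zero_of_face_le_face hΦ h.le (hΔ hα) fun k hk => hzero k (hk.trans_lt hj)
  have hαx : ((⟨α, hΔ hα⟩, i) : Φ × Fin n) ∈ lexNonneg (rootForm Φ n) x :=
    ⟨hxzero, hx α hα i hxzero⟩
  exact (face_le_face_iff.1 h.ge hαx).2

theorem stdStratum_eq_cell (hΦ : IsRootSystem Φ) (hΔ : IsSimpleSystem Φ Δ) (hI : I ∈ flags Δ n)
    (hx : x ∈ stdStratum I) : stdStratum I = (face (rootForm Φ n) x).cell := by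
  have hdom : IsLexDominant Δ x := fun α hα i h =>
    inner_nonneg_of_forall_inner_eq_zero hI hx (Submodule.subset_span hα) h
  refine Set.Subset.antisymm
    (fun y hy => face_eq_face_of_mem_stdStratum hΔ hI hy hx) fun y hy => ?_
  have hflag : vanishingFlag Δ y = vanishingFlag Δ x := funext fun k =>
    Set.Subset.antisymm (vanishingFlag_subset_of_face_le_face hΦ hΔ.subset hy.ge k)
      (vanishingFlag_subset_of_face_le_face hΦ hΔ.subset hy.le k)
  rw [eq_vanishingFlag_of_mem_stdStratum hI hx, ← hflag]
  exact (isLexDominant_of_face_eq hΦ hΔ.subset hdom hy.symm).mem_stdStratum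

theorem mem_lexNonneg_map_iff (hΦ : IsRootSystem Φ) (hw : w ∈ weylGroup Φ) (β : Φ) (i : Fin n) :
    (β, i) ∈ lexNonneg (rootForm Φ n) (fun i => w (x i)) ↔
      (⟨w⁻¹ β.1, hΦ.map_mem (inv_mem hw) β.2⟩, i) ∈ lexNonneg (rootForm Φ n) x := by
  simp only [lexNonneg, Set.mem_ofPred_eq, rootForm_apply, inner_map_left, inv_inv]

theorem face_map_eq_of_face_eq (hΦ : IsRootSystem Φ) (hw : w ∈ weylGroup Φ)
    (h : face (rootForm Φ n) x = face (rootForm Φ n) y) :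
    face (rootForm Φ n) (fun i => w (x i)) = face (rootForm Φ n) fun i => w (y i) := by
  refine face_eq_face_iff.2 (Set.ext fun ⟨β, i⟩ => ?_)
  rw [mem_lexNonneg_map_iff hΦ hw, mem_lexNonneg_map_iff hΦ hw, face_eq_face_iff.1 h]

theorem translate_eq_cell (hΦ : IsRootSystem Φ) (hΔ : IsSimpleSystem Φ Δ) (hw : w ∈ weylGroup Φ)
    (hI : I ∈ flags Δ n) (hx : x ∈ translate w I) :
    translate w I = (face (rootForm Φ n) x).cell := by
  obtain ⟨x, hx, rfl⟩ := hx
  rw [translate, stdStratum_eq_cell hΦ hΔ hI hx]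
  refine Set.Subset.antisymm ?_ fun y hy => ?_
  · rintro _ ⟨y, hy, rfl⟩
    exact face_map_eq_of_face_eq hΦ hw hy
  · refine ⟨fun i => w⁻¹ (y i), ?_, funext fun i => w.apply_symm_apply (y i)⟩
    have := face_map_eq_of_face_eq hΦ (inv_mem hw) hy
    exact this.trans (congrArg (face _) (funext fun i => w.symm_apply_apply (x i)))

end RootFaces

section Strata

variable {V : Type*} [NormedAddCommGroup V] [InnerProductSpace ℝ V] {Φ Δ : Set V} {n : ℕ}
  {I I' : Fin (n + 1) → Set V} {x x' : Fin n → V} {β β' : V}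

theorem inner_eq_zero_of_forall_inner_eq_neg (hI : I ∈ flags Δ n) (hx : x ∈ stdStratum I)
    (hβ : β ∈ Submodule.span ℝ≥0 Δ) (hI' : I' ∈ flags Δ n) (hx' : x' ∈ stdStratum I')
    (hβ' : β' ∈ Submodule.span ℝ≥0 Δ) (h : ∀ i, inner ℝ β' (x' i) = -inner ℝ β (x i))
    (i : Fin n) : inner ℝ β (x i) = 0 := by
  induction i using WellFoundedLT.induction with
  | ind i ih =>
    refine (inner_nonneg_of_forall_inner_eq_zero hI hx hβ ih).antisymm' ?_
    rw [← neg_nonneg, ← h]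
    exact inner_nonneg_of_forall_inner_eq_zero hI' hx' hβ' fun j hj => by rw [h, ih j hj, neg_zero]

theorem map_mem_span_of_mapsTo {w : V ≃ₗᵢ[ℝ] V} {s t : Set V}
    (h : ∀ α ∈ s, w α ∈ Submodule.span ℝ≥0 t) (hβ : β ∈ Submodule.span ℝ≥0 s) :
    w β ∈ Submodule.span ℝ≥0 t :=
  (Submodule.span_le (p := (Submodule.span ℝ≥0 t).comap (w.toLinearMap.restrictScalars ℝ≥0))).2 h hβ

namespace StratumIndex

theorem map_mem_posRoots (hΦ : IsRootSystem Φ) (p : StratumIndex Φ Δ n) (hx : x ∈ stdStratum p.I)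
    (hβ : β ∈ posRoots Φ Δ) (h : ∀ i, inner ℝ β (x i) = 0) : p.w β ∈ posRoots Φ Δ :=
  ⟨hΦ.map_mem p.w_mem hβ.1, map_mem_span_of_mapsTo (fun α hα => (p.mapsTo α hα).2)
    ((forall_inner_eq_zero_iff p.I_mem hx hβ.2 (Fin.last n)).1 fun j _ => h j)⟩

variable [FiniteDimensional ℝ V]

theorem w_eq_of_mem (hΦ : IsRootSystem Φ) (hΔ : IsSimpleSystem Φ Δ) {p q : StratumIndex Φ Δ n}
    (hx : x ∈ stdStratum p.I) (hx' : x' ∈ stdStratum q.I)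
    (h : ∀ i, p.w (x i) = q.w (x' i)) : p.w = q.w := by
  have hu : q.w⁻¹ * p.w ∈ weylGroup Φ := mul_mem (inv_mem q.w_mem) p.w_mem
  refine (inv_mul_eq_one.1 (hΔ.eq_one_of_forall_map_mem_posRoots hΦ hu fun α hα => ?_)).symm
  refine (hΔ.posRoot_or_neg (hΦ.map_mem hu (hΔ.subset hα))).resolve_right fun hneg => ?_
  have hqw : q.w ((q.w⁻¹ * p.w) α) = p.w α := q.w.apply_symm_apply (p.w α)
  have hpos := hΔ.mem_posRoots hα
  have hinner : ∀ i, inner ℝ (-(q.w⁻¹ * p.w) α) (x' i) = -inner ℝ α (x i) := fun i => by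
    rw [inner_neg_left, ← q.w.inner_map_map, hqw, ← h, p.w.inner_map_map]
  have hzero := inner_eq_zero_of_forall_inner_eq_neg p.I_mem hx hpos.2 q.I_mem hx' hneg.2 hinner
  refine hΔ.neg_notMem_posRoots (p.map_mem_posRoots hΦ hx hpos hzero) ?_
  rw [← hqw, ← map_neg]
  exact q.map_mem_posRoots hΦ hx' hneg fun i => by rw [hinner, hzero, neg_zero]

theorem eq_of_mem_translate (hΦ : IsRootSystem Φ) (hΔ : IsSimpleSystem Φ Δ)
    {p q : StratumIndex Φ Δ n} (hp : x ∈ translate p.w p.I) (hq : x ∈ translate q.w q.I) :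
    p = q := by
  obtain ⟨x, hx, rfl⟩ := hp
  obtain ⟨x', hx', hxx'⟩ := hq
  have hw := w_eq_of_mem hΦ hΔ hx hx' fun i => (congrFun hxx' i).symm
  obtain rfl : x' = x := funext fun i => q.w.injective ((congrFun hxx' i).trans (by rw [hw]))
  have hI := (eq_vanishingFlag_of_mem_stdStratum p.I_mem hx).trans
    (eq_vanishingFlag_of_mem_stdStratum q.I_mem hx').symm
  cases p
  cases q
  simp_all

/-- The minimal coset representative is found by making `(x₁, …, xₙ, ρ)` lexicographically
dominant, with `ρ` regular. -/
theorem exists_mem_translate (hΦ : IsRootSystem Φ) (hΔ : IsSimpleSystem Φ Δ) (x : Fin n → V) :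
    ∃ p : StratumIndex Φ Δ n, x ∈ translate p.w p.I := by
  obtain ⟨ρ, hρ⟩ := exists_inner_eq hΔ.linearIndep fun _ => 1
  obtain ⟨w, hw, hdom⟩ := exists_isLexDominant hΦ hΔ (Fin.snoc x ρ : Fin (n + 1) → V)
  have hsnoc : (fun i => w ((Fin.snoc x ρ : Fin (n + 1) → V) i)) =
      Fin.snoc (fun i => w (x i)) (w ρ) := Fin.comp_snoc w x ρ
  obtain ⟨hx, hρw⟩ := isLexDominant_snoc_iff.1 (hsnoc ▸ hdom)
  refine ⟨⟨w⁻¹, vanishingFlag Δ fun i => w (x i), inv_mem hw, vanishingFlag_mem_flags _ _,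
    fun α hα => ?_⟩, fun i => w (x i), hx.mem_stdStratum, funext fun i => w.symm_apply_apply _⟩
  refine hΔ.posRoot_of_inner_nonneg hΦ (fun α hα => (hρ α hα).symm ▸ one_pos)
    (hΦ.map_mem (inv_mem hw) (hΔ.subset hα.1)) ?_
  rw [inner_map_left, inv_inv]
  exact hρw α hα

end StratumIndex

namespace Stratum

theorem ext_carrier {F G : Stratum Φ Δ n} (h : F.carrier = G.carrier) : F = G := by
  cases F
  cases G
  simpa using h

theorem carrier_eq_cell (hΦ : IsRootSystem Φ) (hΔ : IsSimpleSystem Φ Δ) (F : Stratum Φ Δ n)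
    (hx : x ∈ F.carrier) : F.carrier = (face (rootForm Φ n) x).cell := by
  obtain ⟨w, hw, I, hI, h⟩ := F.exists_eq
  rw [h] at hx ⊢
  exact translate_eq_cell hΦ hΔ hw hI hx

theorem zero_mem_zero : (0 : Fin n → V) ∈ (zero Φ Δ n).carrier :=
  ⟨0, fun _ => ⟨fun _ _ => inner_zero_right _, fun _ hα => absurd hα.1 hα.2⟩, rfl⟩

variable [FiniteDimensional ℝ V]

theorem carrier_nonempty (hΔ : LinearIndepOn ℝ id Δ) (F : Stratum Φ Δ n) : F.carrier.Nonempty := by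
  obtain ⟨w, -, I, hI, h⟩ := F.exists_eq
  exact h ▸ (stdStratum_nonempty hΔ hI).image _

theorem exists_carrier_eq_cell (hΦ : IsRootSystem Φ) (hΔ : IsSimpleSystem Φ Δ)
    (G : LexFace (rootForm Φ n)) : ∃ F : Stratum Φ Δ n, F.carrier = G.cell := by
  obtain ⟨x, rfl⟩ := face_surjective _ G
  obtain ⟨p, hp⟩ := StratumIndex.exists_mem_translate hΦ hΔ x
  exact ⟨p.toStratum, p.toStratum.carrier_eq_cell hΦ hΔ hp⟩

end Stratum

variable [FiniteDimensional ℝ V]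

/-- The strata are the faces of the root forms. -/
def faceIsoStratum (hΦ : IsRootSystem Φ) (hΔ : IsSimpleSystem Φ Δ) :
    LexFace (rootForm Φ n) ≃o Stratum Φ Δ n where
  toEquiv := Equiv.ofBijective
    (fun G => ⟨G.cell, by
      obtain ⟨F, hF⟩ := Stratum.exists_carrier_eq_cell hΦ hΔ G
      exact hF ▸ F.exists_eq⟩) <| by
    constructor
    · intro G G' h
      obtain ⟨x, rfl⟩ := face_surjective _ G
      exact LexFace.mem_cell.1 ((congrArg Stratum.carrier h).subset rfl)
    · intro F
      obtain ⟨x, hx⟩ := F.carrier_nonempty hΔ.linearIndep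
      exact ⟨face _ x, Stratum.ext_carrier (F.carrier_eq_cell hΦ hΔ hx).symm⟩
  map_rel_iff' {G G'} := by
    have := hΦ.finite.to_subtype
    exact (isSymmetricFamily_rootForm hΦ n).closure_cell_subset_iff

theorem carrier_faceIsoStratum (hΦ : IsRootSystem Φ) (hΔ : IsSimpleSystem Φ Δ)
    (G : LexFace (rootForm Φ n)) : (faceIsoStratum hΦ hΔ G).carrier = G.cell := rfl

theorem faceIsoStratum_bot (hΦ : IsRootSystem Φ) (hΔ : IsSimpleSystem Φ Δ) :
    faceIsoStratum hΦ hΔ ⊥ = Stratum.zero Φ Δ n :=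
  Stratum.ext_carrier (Stratum.carrier_eq_cell hΦ hΔ _ Stratum.zero_mem_zero).symm

theorem Stratum.eq_of_le_of_ge (hΦ : IsRootSystem Φ) (hΔ : IsSimpleSystem Φ Δ)
    {F G : Stratum Φ Δ n} (h : F ≤ G) (h' : G ≤ F) : F = G :=
  let e := (faceIsoStratum (n := n) hΦ hΔ).symm
  e.injective ((e.monotone h).antisymm (e.monotone h'))

theorem Stratum.isBot_zero (hΦ : IsRootSystem Φ) (hΔ : IsSimpleSystem Φ Δ) :
    IsBot (Stratum.zero Φ Δ n) := fun F => by
  rw [← faceIsoStratum_bot hΦ hΔ, ← (faceIsoStratum hΦ hΔ).le_symm_apply]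
  exact bot_le

theorem StratumIndex.toStratum_bijective (hΦ : IsRootSystem Φ) (hΔ : IsSimpleSystem Φ Δ) :
    Function.Bijective (StratumIndex.toStratum : StratumIndex Φ Δ n → Stratum Φ Δ n) := by
  refine ⟨fun p q h => ?_, fun F => ?_⟩
  · obtain ⟨x, hx⟩ := p.toStratum.carrier_nonempty hΔ.linearIndep
    exact eq_of_mem_translate hΦ hΔ hx ((congrArg Stratum.carrier h).subset hx)
  · obtain ⟨x, hx⟩ := F.carrier_nonempty hΔ.linearIndep
    obtain ⟨p, hp⟩ := exists_mem_translate hΦ hΔ x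
    refine ⟨p, Stratum.ext_carrier ?_⟩
    rw [F.carrier_eq_cell hΦ hΔ hx, p.toStratum.carrier_eq_cell hΦ hΔ hp]

/-- The pairs `(w, I)` index the strata. -/
def stratumIndexIso (hΦ : IsRootSystem Φ) (hΔ : IsSimpleSystem Φ Δ) :
    StratumIndex Φ Δ n ≃o Stratum Φ Δ n where
  toEquiv := Equiv.ofBijective _ (StratumIndex.toStratum_bijective hΦ hΔ)
  map_rel_iff' := Iff.rfl

end Strata

section Restriction

variable {E E' B ι : Type*} [AddCommGroup E] [Module ℝ E] [AddCommGroup E'] [Module ℝ E']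
  {f : B → ι → E →ₗ[ℝ] ℝ}

theorem IsSymmetricFamily.comp (hf : IsSymmetricFamily f) (g : E' →ₗ[ℝ] E) :
    IsSymmetricFamily fun b i => f b i ∘ₗ g := fun b =>
  (hf b).imp fun _ hb' => funext fun i => by simp [hb', LinearMap.neg_comp]

/-- If every point has the same coordinates under `f` as some point in the image of `g`, pulling
back along `g` does not change the face poset. -/
def lexFaceCompIso [LinearOrder ι] (g : E' →ₗ[ℝ] E) (hg : ∀ x, ∃ y, ∀ b i, f b i (g y) = f b i x) :
    LexFace (fun b i => f b i ∘ₗ g) ≃o LexFace f :=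
  (OrderIso.setCongr _ _ <| by
    refine Set.Subset.antisymm ?_ ?_
    · rintro _ ⟨y, rfl⟩
      exact ⟨g y, rfl⟩
    · rintro _ ⟨x, rfl⟩
      obtain ⟨y, hy⟩ := hg x
      exact ⟨y, by simp only [lexNonneg, LinearMap.comp_apply, hy]⟩).dual

/-- An isomorphism of posets restricts to the complements of corresponding elements. -/
def orderIsoSubtypeNe {P Q : Type*} [Preorder P] [Preorder Q] (e : P ≃o Q) {a : P} {b : Q}
    (h : e a = b) : {x : P // x ≠ a} ≃o {y : Q // y ≠ b} where
  toEquiv := e.toEquiv.subtypeEquiv fun _ => (e.injective.ne_iff' h).symm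
  map_rel_iff' := e.map_rel_iff

end Restriction

section Decomposition

variable {V : Type*} [NormedAddCommGroup V] [InnerProductSpace ℝ V] {Φ Δ : Set V} {n : ℕ}

theorem finrank_pi_const_fin (n : ℕ) (U : Type*) [AddCommGroup U] [Module ℝ U]
    [FiniteDimensional ℝ U] : Module.finrank ℝ (Fin n → U) = n * Module.finrank ℝ U := by
  simp [Module.finrank_pi_fintype]

theorem finrank_span_of_linearIndepOn {s : Set V} (hs : LinearIndepOn ℝ id s) :
    Module.finrank ℝ (Submodule.span ℝ s) = s.ncard := by
  have := Module.finrank_eq_nat_card_basis (Module.Basis.span hs.linearIndependent)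
  rwa [show Set.range (fun x : s => id (x : V)) = s from Subtype.range_coe] at this

theorem rootForm_separating (hΔ : Δ ⊆ Φ) (hspan : Submodule.span ℝ Δ = ⊤) (x : Fin n → V)
    (hx : ∀ β i, rootForm Φ n β i x = 0) : x = 0 :=
  funext fun i => eq_zero_of_mem_span_of_forall_inner_eq_zero
    (hspan ▸ Submodule.mem_top : x i ∈ Submodule.span ℝ Δ) fun α hα => hx ⟨α, hΔ hα⟩ i

/-- The restriction of the root forms to `(ℝΔ)ⁿ`. -/
def spanRootForm (Φ Δ : Set V) (n : ℕ) (β : Φ) (i : Fin n) :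
    (Fin n → Submodule.span ℝ Δ) →ₗ[ℝ] ℝ :=
  rootForm Φ n β i ∘ₗ (Submodule.span ℝ Δ).subtype.compLeft (Fin n)

theorem spanRootForm_separating (hΔ : Δ ⊆ Φ) (x : Fin n → Submodule.span ℝ Δ)
    (hx : ∀ β i, spanRootForm Φ Δ n β i x = 0) : x = 0 :=
  funext fun i => Subtype.ext <| eq_zero_of_mem_span_of_forall_inner_eq_zero
    (x i).2 fun α hα => hx ⟨α, hΔ hα⟩ i

variable [FiniteDimensional ℝ V]

theorem exists_rootForm_compLeft_eq (hΔ : IsSimpleSystem Φ Δ) (x : Fin n → V) :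
    ∃ y : Fin n → Submodule.span ℝ Δ, ∀ β i,
      rootForm Φ n β i ((Submodule.span ℝ Δ).subtype.compLeft (Fin n) y) = rootForm Φ n β i x :=
  ⟨fun i => (Submodule.span ℝ Δ).orthogonalProjectionOnto (x i), fun β i =>
    (Submodule.span ℝ Δ).inner_orthogonalProjectionOnto_eq_of_mem_left
      ⟨β, hΔ.mem_span β.2⟩ (x i)⟩

/-- The strata are the faces of the restrictions of the root forms to `(ℝΔ)ⁿ`, which have the
advantage of separating points. -/
def stratumIndexIsoFace (hΦ : IsRootSystem Φ) (hΔ : IsSimpleSystem Φ Δ) :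
    StratumIndex Φ Δ n ≃o LexFace (spanRootForm Φ Δ n) :=
  ((stratumIndexIso hΦ hΔ).trans (faceIsoStratum hΦ hΔ).symm).trans
    (lexFaceCompIso _ (exists_rootForm_compLeft_eq hΔ)).symm

theorem stratumIndexIsoFace_zero (hΦ : IsRootSystem Φ) (hΔ : IsSimpleSystem Φ Δ) :
    stratumIndexIsoFace hΦ hΔ (StratumIndex.zero hΔ.subset n) = ⊥ := by
  have h := ((faceIsoStratum hΦ hΔ).symm_apply_eq).2 (faceIsoStratum_bot (n := n) hΦ hΔ).symm
  exact (congrArg _ h).trans (lexFaceCompIso _ (exists_rootForm_compLeft_eq hΔ)).symm.map_bot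

theorem setOf_raysOf_carrier_eq_rayCells (hΦ : IsRootSystem Φ) (hΔ : IsSimpleSystem Φ Δ) :
    {c | ∃ F : Stratum Φ Δ n, F ≠ Stratum.zero Φ Δ n ∧ c = raysOf F.carrier} =
      rayCells (rootForm Φ n) := by
  ext c
  refine (faceIsoStratum hΦ hΔ).surjective.exists.trans (exists_congr fun G => ?_)
  rw [(faceIsoStratum hΦ hΔ).injective.ne_iff' (faceIsoStratum_bot hΦ hΔ),
    carrier_faceIsoStratum]

theorem isRegularCellDecomposition_strata (hΦ : IsRootSystem Φ) (hΔ : IsSimpleSystem Φ Δ)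
    (hspan : Submodule.span ℝ Δ = ⊤) : IsRegularCellDecomposition
      {c | ∃ F : Stratum Φ Δ n, F ≠ Stratum.zero Φ Δ n ∧ c = raysOf F.carrier} := by
  have := hΦ.finite.to_subtype
  rw [setOf_raysOf_carrier_eq_rayCells hΦ hΔ]
  exact (isSymmetricFamily_rootForm hΦ n).isRegularCellDecomposition_rayCells
    (rootForm_separating hΔ.subset hspan)

theorem exists_orderIso_facePoset_strata (hΦ : IsRootSystem Φ) (hΔ : IsSimpleSystem Φ Δ) :
    ∃ e : {F : Stratum Φ Δ n // F ≠ Stratum.zero Φ Δ n} ≃o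
        FacePoset {c | ∃ F : Stratum Φ Δ n, F ≠ Stratum.zero Φ Δ n ∧ c = raysOf F.carrier},
      ∀ F, (e F : Set (RaySpace (Fin n → V))) = closure (raysOf F.1.carrier) := by
  have := hΦ.finite.to_subtype
  rw [setOf_raysOf_carrier_eq_rayCells hΦ hΔ]
  let e := faceIsoStratum (n := n) hΦ hΔ
  refine ⟨(orderIsoSubtypeNe e (faceIsoStratum_bot hΦ hΔ)).symm.trans
    ((isSymmetricFamily_rootForm hΦ n).facePosetIso), fun F => ?_⟩
  have hF : (e.symm F.1).cell = F.1.carrier := congrArg Stratum.carrier (e.apply_symm_apply F.1)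
  exact congrArg (fun C => closure (raysOf C)) hF

theorem exists_isRegularCellDecomposition_stdSphere (hΦ : IsRootSystem Φ)
    (hΔ : IsSimpleSystem Φ Δ) :
    ∃ E : Set (Set (StdSphere (n * Δ.ncard))), IsRegularCellDecomposition E ∧
      Nonempty ({p : StratumIndex Φ Δ n // p ≠ StratumIndex.zero hΔ.subset n} ≃o
        FacePoset E) := by
  have := hΦ.finite.to_subtype
  have hf : IsSymmetricFamily (spanRootForm Φ Δ n) := (isSymmetricFamily_rootForm hΦ n).comp _
  have hsep := spanRootForm_separating (n := n) hΔ.subset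
  obtain ⟨φ⟩ := nonempty_raySpace_homeo_stdSphere (U := Fin n → Submodule.span ℝ Δ)
    ((finrank_pi_const_fin n _).trans (congrArg (n * ·)
      (finrank_span_of_linearIndepOn hΔ.linearIndep)))
  exact ⟨_, (hf.isRegularCellDecomposition_rayCells hsep).image φ,
    ⟨((orderIsoSubtypeNe _ (stratumIndexIsoFace_zero hΦ hΔ)).trans
      (hf.facePosetIso)).trans (facePosetImage _ φ)⟩⟩

theorem finite_stratumIndex (hΦ : IsRootSystem Φ) (hΔ : IsSimpleSystem Φ Δ) :
    Finite (StratumIndex Φ Δ n) :=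
  have := hΦ.finite.to_subtype
  Finite.of_equiv _ (stratumIndexIsoFace hΦ hΔ).symm.toEquiv

theorem isGradedPoset_withTop_stratumIndex (hΦ : IsRootSystem Φ) (hΔ : IsSimpleSystem Φ Δ) :
    IsGradedPoset (WithTop (StratumIndex Φ Δ n)) := by
  have := hΦ.finite.to_subtype
  have hf : IsSymmetricFamily (spanRootForm Φ Δ n) := (isSymmetricFamily_rootForm hΦ n).comp _
  let e := stratumIndexIsoFace (n := n) hΦ hΔ
  let _ : PartialOrder (StratumIndex Φ Δ n) :=
    { (inferInstance : Preorder (StratumIndex Φ Δ n)) with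
      le_antisymm := fun _ _ h h' => e.injective ((e.monotone h).antisymm (e.monotone h')) }
  exact (hf.isGradedPoset_withTop_lexFace (spanRootForm_separating hΔ.subset)).of_orderIso
    e.symm.withTopCongr

end Decomposition

end DiagonalStrata

end

theorem proposition4p3 {V : Type*} [NormedAddCommGroup V] [InnerProductSpace ℝ V]
    [FiniteDimensional ℝ V] (Φ Δ : Set V) (hΦ : DiagonalStrata.IsRootSystem Φ)
    (hΔ : DiagonalStrata.IsSimpleSystem Φ Δ) (n : ℕ) (hn : 1 ≤ n) :
    -- the strata and their indices are partially ordered, with minimum `0̂`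
    ((∀ F G : DiagonalStrata.Stratum Φ Δ n, F ≤ G → G ≤ F → F = G) ∧
      IsBot (DiagonalStrata.Stratum.zero Φ Δ n) ∧
      Function.Bijective
        (DiagonalStrata.StratumIndex.toStratum : DiagonalStrata.StratumIndex Φ Δ n → _)) ∧
    -- if the simple roots span `V`, the `[F]` form a regular cell decomposition of the space of
    -- rays, a sphere, with face poset the poset of strata without `0̂`
    (Submodule.span ℝ Δ = ⊤ →
      Module.finrank ℝ V = Δ.ncard ∧
      Nonempty (DiagonalStrata.RaySpace (Fin n → V) ≃ₜ
        DiagonalStrata.StdSphere (n * Module.finrank ℝ V)) ∧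
      DiagonalStrata.IsRegularCellDecomposition
        {c | ∃ F : DiagonalStrata.Stratum Φ Δ n, F ≠ DiagonalStrata.Stratum.zero Φ Δ n ∧
          c = DiagonalStrata.raysOf F.carrier} ∧
      ∃ e : {F : DiagonalStrata.Stratum Φ Δ n // F ≠ DiagonalStrata.Stratum.zero Φ Δ n} ≃o
          DiagonalStrata.FacePoset
            {c | ∃ F : DiagonalStrata.Stratum Φ Δ n, F ≠ DiagonalStrata.Stratum.zero Φ Δ n ∧
              c = DiagonalStrata.raysOf F.carrier},
        ∀ F, (e F : Set (DiagonalStrata.RaySpace (Fin n → V))) =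
          closure (DiagonalStrata.raysOf F.1.carrier)) ∧
    -- in general, the index poset without `0̂` is the face poset of a regular cell decomposition
    -- of the sphere of dimension `n |Δ| - 1`
    (∃ E : Set (Set (DiagonalStrata.StdSphere (n * Δ.ncard))),
      DiagonalStrata.IsRegularCellDecomposition E ∧
      Nonempty ({p : DiagonalStrata.StratumIndex Φ Δ n //
          p ≠ DiagonalStrata.StratumIndex.zero hΔ.subset n} ≃o DiagonalStrata.FacePoset E)) ∧
    -- the index poset with a maximum adjoined is finite and graded
    Finite (WithTop (DiagonalStrata.StratumIndex Φ Δ n)) ∧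
    DiagonalStrata.IsGradedPoset (WithTop (DiagonalStrata.StratumIndex Φ Δ n)) := by
  have hfin := DiagonalStrata.finite_stratumIndex (n := n) hΦ hΔ
  refine ⟨⟨fun _ _ => DiagonalStrata.Stratum.eq_of_le_of_ge hΦ hΔ,
    DiagonalStrata.Stratum.isBot_zero hΦ hΔ,
    DiagonalStrata.StratumIndex.toStratum_bijective hΦ hΔ⟩, fun hspan => ⟨?_,
      DiagonalStrata.nonempty_raySpace_homeo_stdSphere (DiagonalStrata.finrank_pi_const_fin n V),
      DiagonalStrata.isRegularCellDecomposition_strata hΦ hΔ hspan,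
      DiagonalStrata.exists_orderIso_facePoset_strata hΦ hΔ⟩,
    DiagonalStrata.exists_isRegularCellDecomposition_stdSphere hΦ hΔ,
    inferInstanceAs (Finite (Option (DiagonalStrata.StratumIndex Φ Δ n))),
    DiagonalStrata.isGradedPoset_withTop_stratumIndex hΦ hΔ⟩
  rw [← DiagonalStrata.finrank_span_of_linearIndepOn hΔ.linearIndep, hspan, finrank_top]
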